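/- Let $d\mu(z)=\pi^{-1}e^{-|z|^2}\,dz$ on $\mathbb C$, let $F^2$ be the Fock space of all entire functions in $L^2(\mathbb C,\mu)$, and let $P$ be the orthogonal projection of $L^2(\mathbb C,\mu)$ onto $F^2$. The Toeplitz algebra $\mathcal T$ is the $C^*$-algebra of operators on $F^2$ generated by all Toeplitz operators $T_f g=P(fg)$, $f\in L^\infty(\mathbb C)$. For $z\in\mathbb C$ let $k_z(w)=e^{w\bar z-|z|^2/2}$, and let the Weyl operator $W_z$ be $W_zf(w)=k_z(w)f(w-z)$. For $\psi\in F^2$ and $\varphi$ entire, let $W_{\psi,\varphi}f=\psi\cdot(f\circ\varphi)$ be the weighted composition operator, and put $M_z(\psi,\varphi)=|\psi(z)|^2e^{|\varphi(z)|^2-|z|^2}$. (A) Let $\psi\in F^2$ and $\varphi$ entire be such that $W_{\psi,\varphi}$ is bounded on $F^2$. Then $W_{\psi,\varphi}\in\mathcal T$ if and only if $W_{\psi,\varphi}$ is compact or a constant multiple of a Weyl operator, i.e. $W_{\psi,\varphi}=c\,W_z$ for some $c,z\in\mathbb C$. Moreover, if $\psi\not\equiv0$, then there are $a,\lambda\in\mathbb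 C$ with $|\lambda|\le1$ such that $\varphi(w)=a+\lambda w$ for all $w$. In terms of the symbols, whenever $\varphi(w)=a+\lambda w$: 1. if $|\lambda|=1$ and $\psi\not\equiv 0$, then $W_{\psi,\varphi}\in\mathcal T$ if and only if $\lambda=1$; 2. if $\lambda=0$, then $W_{\psi,\varphi}\in\mathcal T$; 3. if $0<|\lambda|<1$, then $W_{\psi,\varphi}\in\mathcal T$ if and only if $M_z(\psi,\varphi)\to0$ as $|z|\to\infty$. (B) If $\varphi(w)=a+\lambda w$ with $0<|\lambda|<1$, then $W_{1,\varphi}$ is bounded on $F^2$ and $W_{1,\varphi}\in\mathcal T$. -/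

import Mathlib

open MeasureTheory Filter Topology
open scoped ENNReal Real

namespace Fock
noncomputable section

/-- The Gaussian measure `dμ(z) = π⁻¹ exp (-|z|²) dz` on `ℂ`. -/
def gaussian : Measure ℂ :=
  volume.withDensity fun z => ENNReal.ofReal (π⁻¹ * Real.exp (-‖z‖ ^ 2))

theorem measurable_density :
    Measurable fun z : ℂ => ENNReal.ofReal (π⁻¹ * Real.exp (-‖z‖ ^ 2)) := by
  fun_prop

theorem gaussian_univ : gaussian Set.univ = 1 := by
  have h := GaussianFourier.integral_rexp_neg_mul_sq_norm (V := ℂ) (b := 1) one_pos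
  simp only [Complex.finrank_real_complex] at h
  have h1 : ∫ z : ℂ, π⁻¹ * Real.exp (-‖z‖ ^ 2) = 1 := by
    rw [integral_const_mul]
    simp only [neg_mul, one_mul] at h
    rw [h]
    simp [Real.pi_ne_zero]
  have hi : Integrable fun z : ℂ => π⁻¹ * Real.exp (-‖z‖ ^ 2) := by
    by_contra hc
    rw [integral_undef hc] at h1
    exact zero_ne_one h1
  rw [gaussian, withDensity_apply _ MeasurableSet.univ, Measure.restrict_univ,
    ← ofReal_integral_eq_lintegral_ofReal hi (ae_of_all _ fun z => by positivity), h1,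
    ENNReal.ofReal_one]

instance : IsProbabilityMeasure gaussian := ⟨gaussian_univ⟩

theorem volume_absolutelyContinuous : (volume : Measure ℂ) ≪ gaussian :=
  withDensity_absolutelyContinuous' measurable_density.aemeasurable
    (ae_of_all _ fun z => by
      simp only [ne_eq, ENNReal.ofReal_eq_zero, not_le]; positivity)

theorem gaussian_absolutelyContinuous : gaussian ≪ (volume : Measure ℂ) :=
  withDensity_absolutelyContinuous _ _

/-- Two continuous functions that agree almost everywhere are equal. -/
theorem eq_of_ae {F G : ℂ → ℂ} (hF : Continuous F) (hG : Continuous G)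
    (h : F =ᵐ[gaussian] G) : F = G :=
  Continuous.ae_eq_iff_eq volume hF hG |>.1 (volume_absolutelyContinuous.ae_le h)

theorem lintegral_gaussian (g : ℂ → ℝ≥0∞) (hg : Measurable g) :
    ∫⁻ z, g z ∂gaussian = ∫⁻ z, ENNReal.ofReal (π⁻¹ * Real.exp (-‖z‖ ^ 2)) * g z :=
  lintegral_withDensity_eq_lintegral_mul _ measurable_density hg

theorem eLpNorm_two_sq (F : ℂ → ℂ) :
    eLpNorm F 2 gaussian ^ 2 = ∫⁻ z, ‖F z‖ₑ ^ 2 ∂gaussian := by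
  have := eLpNorm_nnreal_pow_eq_lintegral (f := F) (μ := gaussian) (p := 2) (by norm_num)
  simpa using this

/-- The normalized reproducing kernel `k_z(w) = exp (w * conj z - |z|² / 2)`. -/
def kernel (z w : ℂ) : ℂ :=
  Complex.exp (w * starRingEnd ℂ z - (‖z‖ : ℂ) ^ 2 / 2)

theorem lintegral_weyl (z : ℂ) (F : ℂ → ℂ) (hF : Continuous F) :
    ∫⁻ w, ‖kernel z w * F (w - z)‖ₑ ^ 2 ∂gaussian = ∫⁻ w, ‖F w‖ₑ ^ 2 ∂gaussian := by
  have hk : Continuous (kernel z) := by unfold kernel; fun_prop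
  rw [lintegral_gaussian _ (by fun_prop), lintegral_gaussian _ (by fun_prop),
    ← lintegral_sub_right_eq_self (μ := volume)
      (fun w => ENNReal.ofReal (π⁻¹ * Real.exp (-‖w‖ ^ 2)) * ‖F w‖ₑ ^ 2) z]
  refine lintegral_congr fun w => ?_
  rw [enorm_mul, mul_pow, ← mul_assoc]
  congr 1
  rw [← ofReal_norm, ← ENNReal.ofReal_pow (norm_nonneg _),
    ← ENNReal.ofReal_mul (by positivity)]
  congr 1
  rw [mul_assoc, kernel, Complex.norm_exp, ← Real.exp_nat_mul, ← Real.exp_add]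
  congr 2
  simp only [← Complex.normSq_eq_norm_sq, ← Complex.ofReal_pow]
  simp [Complex.normSq_apply]
  ring

/-- The sub-mean value property of `|F|²` over circles. -/
theorem circle_mean (F : ℂ → ℂ) (hF : Differentiable ℂ F) (r : ℝ) :
    ENNReal.ofReal (2 * π) * ‖F 0‖ₑ ^ 2 ≤
      ∫⁻ θ in Set.Ioo (-π) π, ‖F (circleMap 0 r θ)‖ₑ ^ 2 := by
  have h : Real.circleAverage (fun z => F z ^ 2) 0 r = F 0 ^ 2 :=
    DiffContOnCl.circleAverage (hF.pow 2).diffContOnCl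
  rw [Real.circleAverage_eq_integral_add (-π),
    intervalIntegral.integral_comp_add_right (fun θ => F (circleMap 0 r θ) ^ 2),
    intervalIntegral.integral_of_le (by linarith [Real.pi_pos]),
    inv_smul_eq_iff₀ (by positivity)] at h
  have h2 := congrArg (fun x : ℂ => ‖x‖ₑ) h
  simp only [enorm_smul, enorm_pow] at h2
  rw [Real.enorm_of_nonneg (by positivity)] at h2
  rw [← h2, show 0 + -π = -π by ring, show 2 * π + -π = π by ring]
  refine (enorm_integral_le_lintegral_enorm _).trans (le_of_eq ?_)
  simp only [enorm_pow]
  exact setLIntegral_congr Ioo_ae_eq_Ioc.symm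

theorem enorm_zero_le (F : ℂ → ℂ) (hF : Differentiable ℂ F) :
    ‖F 0‖ₑ ≤ eLpNorm F 2 gaussian := by
  have key : ∀ G : ℂ → ℂ, Continuous G → ∫⁻ z, ‖G z‖ₑ ^ 2 ∂gaussian =
      ∫⁻ r in Set.Ioi (0 : ℝ), ENNReal.ofReal r * ENNReal.ofReal (π⁻¹ * Real.exp (-r ^ 2)) *
        ∫⁻ θ in Set.Ioo (-π) π, ‖G (circleMap 0 r θ)‖ₑ ^ 2 := by
    intro G hG
    rw [lintegral_gaussian _ (by fun_prop), ← Complex.lintegral_comp_polarCoord_symm]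
    have hm : Measurable fun p : ℝ × ℝ => ENNReal.ofReal p.1 *
        (ENNReal.ofReal (π⁻¹ * Real.exp (-p.1 ^ 2)) * ‖G (circleMap 0 p.1 p.2)‖ₑ ^ 2) := by
      have : Continuous fun p : ℝ × ℝ => G (circleMap 0 p.1 p.2) := by
        unfold circleMap; fun_prop
      have := this.measurable.enorm.pow_const 2
      fun_prop
    have e : ∀ p : ℝ × ℝ, p ∈ polarCoord.target → ENNReal.ofReal p.1 •
        (ENNReal.ofReal (π⁻¹ * Real.exp (-‖Complex.polarCoord.symm p‖ ^ 2)) *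
          ‖G (Complex.polarCoord.symm p)‖ₑ ^ 2) = ENNReal.ofReal p.1 *
        (ENNReal.ofReal (π⁻¹ * Real.exp (-p.1 ^ 2)) * ‖G (circleMap 0 p.1 p.2)‖ₑ ^ 2) := by
      intro p hp
      have : Complex.polarCoord.symm p = circleMap 0 p.1 p.2 := by
        simp [circleMap, Complex.exp_mul_I]
      rw [this, norm_circleMap_zero, sq_abs, smul_eq_mul]
    rw [setLIntegral_congr_fun polarCoord.open_target.measurableSet e, polarCoord_target,
      Measure.volume_eq_prod, ← Measure.prod_restrict, lintegral_prod _ hm.aemeasurable]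
    refine lintegral_congr fun r => ?_
    simp only [← mul_assoc]
    rw [lintegral_const_mul]
    have : Continuous fun θ : ℝ => G (circleMap 0 r θ) := by
      unfold circleMap; fun_prop
    exact this.measurable.enorm.pow_const 2
  have h0 := key (fun _ => F 0) continuous_const
  have h1 := key F hF.continuous
  rw [lintegral_const, measure_univ, mul_one] at h0
  have : ‖F 0‖ₑ ^ 2 ≤ eLpNorm F 2 gaussian ^ 2 := by
    rw [eLpNorm_two_sq, h0, h1]
    refine lintegral_mono fun r => mul_le_mul_right ?_ _
    refine le_trans (le_of_eq ?_) (circle_mean F hF r)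
    rw [lintegral_const, Measure.restrict_apply_univ, Real.volume_Ioo, mul_comm]
    congr 2
    ring
  exact (ENNReal.pow_le_pow_left_iff two_ne_zero).1 this

theorem differentiable_kernel (z : ℂ) : Differentiable ℂ (kernel z) := by
  unfold kernel; fun_prop

theorem eLpNorm_weyl (z : ℂ) (F : ℂ → ℂ) (hF : Continuous F) :
    eLpNorm (fun w => kernel z w * F (w - z)) 2 gaussian = eLpNorm F 2 gaussian := by
  have h : ∀ x y : ℝ≥0∞, x ^ 2 = y ^ 2 → x = y := fun x y h =>
    le_antisymm ((ENNReal.pow_le_pow_left_iff two_ne_zero).1 h.le)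
      ((ENNReal.pow_le_pow_left_iff two_ne_zero).1 h.ge)
  refine h _ _ ?_
  rw [eLpNorm_two_sq, eLpNorm_two_sq]
  exact lintegral_weyl z F hF

theorem enorm_kernel_mul_le (F : ℂ → ℂ) (hF : Differentiable ℂ F) (z : ℂ) :
    ‖kernel (-z) 0 * F z‖ₑ ≤ eLpNorm F 2 gaussian := by
  rw [← eLpNorm_weyl (-z) F hF.continuous]
  have : Differentiable ℂ fun w => kernel (-z) w * F (w - -z) :=
    (differentiable_kernel _).mul (hF.comp (differentiable_id.sub_const _))
  simpa using enorm_zero_le _ this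

/-- Pointwise evaluation of entire functions is bounded by the norm, locally uniformly. -/
theorem norm_le_exp_mul (F : ℂ → ℂ) (hF : Differentiable ℂ F) (hL : MemLp F 2 gaussian) (z : ℂ) :
    ‖F z‖ ≤ Real.exp (‖z‖ ^ 2 / 2) * (eLpNorm F 2 gaussian).toReal := by
  have h := ENNReal.toReal_mono hL.2.ne (enorm_kernel_mul_le F hF z)
  rw [toReal_enorm, norm_mul] at h
  have hk : ‖kernel (-z) 0‖ = Real.exp (-(‖z‖ ^ 2 / 2)) := by
    rw [kernel, Complex.norm_exp]
    congr 1
    simp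
    rw [← Complex.ofReal_pow, Complex.ofReal_re]
  rw [hk, Real.exp_neg, inv_mul_le_iff₀ (Real.exp_pos _)] at h
  exact h

/-- The Fock space `F²` as a subspace of `L²(ℂ, μ)`: the classes of entire functions. -/
def fockSubmodule : Submodule ℂ (Lp ℂ 2 gaussian) where
  carrier := {f | ∃ F : ℂ → ℂ, Differentiable ℂ F ∧ f =ᵐ[gaussian] F}
  add_mem' := by
    rintro f g ⟨F, hF, hf⟩ ⟨G, hG, hg⟩
    exact ⟨F + G, hF.add hG, (Lp.coeFn_add f g).trans (hf.add hg)⟩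
  zero_mem' := ⟨0, differentiable_const 0, Lp.coeFn_zero ℂ 2 gaussian⟩
  smul_mem' := by
    rintro c f ⟨F, hF, hf⟩
    exact ⟨c • F, hF.const_smul c, (Lp.coeFn_smul c f).trans (hf.const_smul c)⟩

/-- The Fock space `F²`, with the norm and inner product of `L²(ℂ, μ)`. -/
def FockSpace : Type := fockSubmodule

instance : NormedAddCommGroup FockSpace := inferInstanceAs (NormedAddCommGroup fockSubmodule)

instance : InnerProductSpace ℂ FockSpace := inferInstanceAs (InnerProductSpace ℂ fockSubmodule)

/-- The inclusion of `F²` into `L²(ℂ, μ)`. -/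
def toL2 : FockSpace →L[ℂ] Lp ℂ 2 gaussian := fockSubmodule.subtypeL

/-- The entire function that an element of `F²` is. -/
def entire (f : FockSpace) : ℂ → ℂ := f.2.choose

theorem differentiable_entire (f : FockSpace) : Differentiable ℂ (entire f) :=
  f.2.choose_spec.1

theorem toL2_ae_entire (f : FockSpace) : toL2 f =ᵐ[gaussian] entire f :=
  f.2.choose_spec.2

theorem entire_eq_of_ae {f : FockSpace} {F : ℂ → ℂ} (hF : Continuous F)
    (h : toL2 f =ᵐ[gaussian] F) : entire f = F :=
  eq_of_ae (differentiable_entire f).continuous hF ((toL2_ae_entire f).symm.trans h)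

theorem memLp_entire (f : FockSpace) : MemLp (entire f) 2 gaussian :=
  (memLp_congr_ae (toL2_ae_entire f)).1 (Lp.memLp _)

theorem entire_add (f g : FockSpace) : entire (f + g) = entire f + entire g :=
  entire_eq_of_ae ((differentiable_entire f).add (differentiable_entire g)).continuous
    ((Lp.coeFn_add _ _).trans ((toL2_ae_entire f).add (toL2_ae_entire g)))

theorem entire_smul (c : ℂ) (f : FockSpace) : entire (c • f) = c • entire f :=
  entire_eq_of_ae ((differentiable_entire f).const_smul c).continuous
    ((Lp.coeFn_smul _ _).trans ((toL2_ae_entire f).const_smul c))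

theorem entire_injective : Function.Injective entire := fun f g h =>
  Subtype.ext (Lp.ext ((toL2_ae_entire f).trans (h ▸ (toL2_ae_entire g).symm)))

theorem norm_eq_eLpNorm_entire (f : FockSpace) : ‖f‖ = (eLpNorm (entire f) 2 gaussian).toReal := by
  rw [← eLpNorm_congr_ae (toL2_ae_entire f)]
  rfl

/-- `IsFock F` says that the function `F` belongs to `F² = L²(ℂ, μ) ∩ Hol(ℂ)`. -/
def IsFock (F : ℂ → ℂ) : Prop := Differentiable ℂ F ∧ MemLp F 2 gaussian

/-- A function in `F²` as an element of the space `FockSpace`. -/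
def ofIsFock (F : ℂ → ℂ) (hF : IsFock F) : FockSpace :=
  ⟨hF.2.toLp F, F, hF.1, hF.2.coeFn_toLp⟩

theorem entire_ofIsFock (F : ℂ → ℂ) (hF : IsFock F) : entire (ofIsFock F hF) = F :=
  entire_eq_of_ae hF.1.continuous hF.2.coeFn_toLp

theorem isClosed_fockSubmodule : IsClosed (fockSubmodule : Set (Lp ℂ 2 gaussian)) := by
  refine isClosed_of_closure_subset fun f hf => ?_
  obtain ⟨u, hu, hlim⟩ := mem_closure_iff_seq_limit.1 hf
  let v : ℕ → FockSpace := fun n => ⟨u n, hu n⟩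
  have hdist : ∀ m n z, dist (entire (v m) z) (entire (v n) z) ≤
      Real.exp (‖z‖ ^ 2 / 2) * dist (u m) (u n) := by
    intro m n z
    have e : entire (v m) - entire (v n) = entire (v m - v n) := by
      rw [sub_eq_add_neg (v m), ← neg_one_smul ℂ (v n), entire_add, entire_smul,
        neg_one_smul, sub_eq_add_neg]
    have := norm_le_exp_mul _ (differentiable_entire (v m - v n)) (memLp_entire _) z
    rw [← norm_eq_eLpNorm_entire, ← e] at this
    rw [dist_eq_norm, dist_eq_norm]
    exact this
  have hcau : CauchySeq u := hlim.cauchySeq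
  have hcz : ∀ z, CauchySeq fun n => entire (v n) z := by
    intro z
    rw [Metric.cauchySeq_iff] at hcau ⊢
    intro ε hε
    obtain ⟨N, hN⟩ := hcau (ε / Real.exp (‖z‖ ^ 2 / 2)) (by positivity)
    refine ⟨N, fun m hm n hn => (hdist m n z).trans_lt ?_⟩
    have := hN m hm n hn
    rwa [lt_div_iff₀ (Real.exp_pos _), mul_comm] at this
  choose G hG using fun z => cauchySeq_tendsto_of_complete (hcz z)
  have hloc : TendstoLocallyUniformlyOn (fun n => entire (v n)) G atTop Set.univ := by
    rw [tendstoLocallyUniformlyOn_iff_forall_isCompact isOpen_univ]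
    intro K _ hK
    obtain ⟨R, hR⟩ := hK.isBounded.exists_norm_le
    refine UniformCauchySeqOn.tendstoUniformlyOn_of_tendsto ?_ fun z _ => hG z
    rw [Metric.uniformCauchySeqOn_iff]
    rw [Metric.cauchySeq_iff] at hcau
    intro ε hε
    obtain ⟨N, hN⟩ := hcau (ε / Real.exp (R ^ 2 / 2)) (by positivity)
    refine ⟨N, fun m hm n hn z hz => (hdist m n z).trans_lt ?_⟩
    have h1 := hN m hm n hn
    rw [lt_div_iff₀ (Real.exp_pos _), mul_comm] at h1
    refine lt_of_le_of_lt ?_ h1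
    have := hR z hz
    gcongr
  have hGd : Differentiable ℂ G := by
    rw [← differentiableOn_univ]
    exact hloc.differentiableOn
      (Eventually.of_forall fun n => (differentiable_entire (v n)).differentiableOn) isOpen_univ
  refine ⟨G, hGd, ?_⟩
  obtain ⟨ns, hns, hae⟩ := (tendstoInMeasure_of_tendsto_Lp hlim).exists_seq_tendsto_ae
  have hall : ∀ᵐ z ∂gaussian, ∀ n, u n z = entire (v n) z :=
    ae_all_iff.2 fun n => toL2_ae_entire (v n)
  filter_upwards [hae, hall] with z h1 h2
  refine tendsto_nhds_unique h1 ?_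
  simp only [h2]
  exact (hG z).comp hns.tendsto_atTop

instance : CompleteSpace fockSubmodule := isClosed_fockSubmodule.completeSpace_coe

instance : CompleteSpace FockSpace := inferInstanceAs (CompleteSpace fockSubmodule)

/-- The orthogonal projection `P` of `L²(ℂ, μ)` onto `F²`. -/
def proj : Lp ℂ 2 gaussian →L[ℂ] FockSpace := fockSubmodule.orthogonalProjectionOnto

/-- The Toeplitz operator `T_f g = P (f g)` with symbol `f ∈ L^∞(ℂ)`. The null sets of `μ` are those of Lebesgue measure, so
`L^∞(ℂ, μ) = L^∞(ℂ)`. -/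
def toeplitz (f : Lp ℂ ∞ gaussian) : FockSpace →L[ℂ] FockSpace :=
  proj ∘L
    (ContinuousLinearMap.mul ℂ ℂ).holderL gaussian ∞ 2 2 f ∘L toL2

/-- The Toeplitz algebra: the `C*`-algebra generated by all Toeplitz operators with bounded
symbols (it contains the identity, which is the Toeplitz operator with symbol `1`). -/
def toeplitzAlgebra : StarSubalgebra ℂ (FockSpace →L[ℂ] FockSpace) :=
  (StarAlgebra.adjoin ℂ (Set.range toeplitz)).topologicalClosure

theorem isFock_weyl (z : ℂ) (f : FockSpace) :
    IsFock fun w => kernel z w * entire f (w - z) := by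
  have h : Differentiable ℂ fun w => kernel z w * entire f (w - z) :=
    (differentiable_kernel z).mul
      ((differentiable_entire f).comp (differentiable_id.sub_const _))
  refine ⟨h, h.continuous.aestronglyMeasurable, ?_⟩
  rw [eLpNorm_weyl z _ (differentiable_entire f).continuous]
  exact (memLp_entire f).2

/-- The Weyl operator `W_z f(w) = k_z(w) f(w - z)`. -/
def weyl (z : ℂ) : FockSpace →L[ℂ] FockSpace :=
  LinearMap.mkContinuous
    { toFun := fun f => ofIsFock (fun w => kernel z w * entire f (w - z)) (isFock_weyl z f)
      map_add' := fun f g => entire_injective <| by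
        funext w
        simp only [entire_add, entire_ofIsFock, Pi.add_apply]
        ring
      map_smul' := fun c f => entire_injective <| by
        funext w
        simp only [entire_smul, entire_ofIsFock, Pi.smul_apply, smul_eq_mul, RingHom.id_apply]
        ring } 1
    fun f => by
      rw [one_mul, norm_eq_eLpNorm_entire, norm_eq_eLpNorm_entire]
      simp only [LinearMap.coe_mk, AddHom.coe_mk, entire_ofIsFock]
      rw [eLpNorm_weyl z _ (differentiable_entire f).continuous]

theorem entire_weyl (z : ℂ) (f : FockSpace) (w : ℂ) :
    entire (weyl z f) w = kernel z w * entire f (w - z) :=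
  congrFun (entire_ofIsFock _ (isFock_weyl z f)) w

/-- `IsWeightedComposition ψ φ W` says that the weighted composition operator
`W_{ψ,φ} f = ψ · (f ∘ φ)` is bounded on `F²` and that `W` is this operator. -/
def IsWeightedComposition (ψ φ : ℂ → ℂ) (W : FockSpace →L[ℂ] FockSpace) : Prop :=
  ∀ f : FockSpace, entire (W f) = fun w => ψ w * entire f (φ w)

/-- `M_z(ψ, φ) = |ψ(z)|² exp (|φ(z)|² - |z|²)`, which is `‖W_{ψ,φ}* k_z‖²` for bounded `W_{ψ,φ}`. -/
def symbolM (ψ φ : ℂ → ℂ) (z : ℂ) : ℝ :=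
  ‖ψ z‖ ^ 2 * Real.exp (‖φ z‖ ^ 2 - ‖z‖ ^ 2)

end
end Fock

namespace Fock
noncomputable section

/-! Membership in the Toeplitz algebra is detected by the matrix elements `⟨k_w, A k_z⟩`. For a
Toeplitz operator they are bounded by a Gaussian in `|z - w|`. Operators with such a bound form a
`*`-algebra, so every operator in its norm closure, hence every operator in `𝒯`, has matrix elements
tending to zero uniformly as `|z - w| → ∞`. For a weighted composition operator the reproducing
property gives `|⟨k_z, W k_{φ(z)}⟩|² = M_z`. If `φ(w) = a + λw` with `λ ≠ 1`, then `|φ(z) - z| → ∞`,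
so `W ∈ 𝒯` forces `M_z → 0`.

The same identity gives `M_z ≤ ‖W‖²`. Taking logarithms and averaging over circles, with Jensen's
formula bounding the mean of `log |ψ|` from below, shows that the mean of `|φ|` over `|z| = r` is at
most `r + O(1/r)`; Cauchy's estimates then make `φ` affine with `|λ| ≤ 1`. When `|λ| = 1`, `M_z` is
a constant times the squared modulus of an entire function. By Liouville, `M_z → 0` gives `ψ = 0`,
while for `λ = 1` boundedness alone makes `W` a multiple of a Weyl operator. When `λ = 0`, `W` has
rank at most one. When `0 < |λ| < 1`, a change of variables turns `‖Wf‖²` into an integral of `|f|²`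
weighted by `M`, and `M_z → 0` makes `W` a norm limit of finite-rank operators.

Conversely `𝒯` contains the Weyl operators, which are multiples of Toeplitz operators, and all
compact operators: the projection onto constants is a limit of Toeplitz operators, Weyl operators
move it to all `k_a ⊗ k_b`, and these span a dense set of finite-rank operators. For (B), `M_z(1,
φ)` has Gaussian decay. -/

/-! ### Normalized kernels and the reproducing property -/

theorem norm_kernel (z w : ℂ) :
    ‖kernel z w‖ = Real.exp (‖w‖ ^ 2 / 2 - ‖w - z‖ ^ 2 / 2) := by
  rw [kernel, Complex.norm_exp]
  congr 1
  simp only [← Complex.normSq_eq_norm_sq, ← Complex.ofReal_pow]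
  simp [Complex.normSq_apply]
  ring

theorem eLpNorm_kernel (z : ℂ) : eLpNorm (kernel z) 2 gaussian = 1 := by
  have h := eLpNorm_weyl z (fun _ => 1) continuous_const
  simp only [mul_one] at h
  rw [show kernel z = fun w => kernel z w from rfl, h, eLpNorm_const _ two_ne_zero (NeZero.ne _)]
  simp

theorem isFock_kernel (z : ℂ) : IsFock (kernel z) :=
  ⟨differentiable_kernel z, (differentiable_kernel z).continuous.aestronglyMeasurable, by
    rw [eLpNorm_kernel]; exact ENNReal.one_lt_top⟩

/-- The normalized reproducing kernel as an element of the Fock space. -/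
def kvec (z : ℂ) : FockSpace := ofIsFock (kernel z) (isFock_kernel z)

theorem entire_kvec (z : ℂ) : entire (kvec z) = kernel z := entire_ofIsFock _ _

theorem norm_kvec (z : ℂ) : ‖kvec z‖ = 1 := by
  rw [norm_eq_eLpNorm_entire, entire_kvec, eLpNorm_kernel, ENNReal.toReal_one]

theorem norm_entire_le (f : FockSpace) (z : ℂ) :
    ‖entire f z‖ ≤ Real.exp (‖z‖ ^ 2 / 2) * ‖f‖ := by
  rw [norm_eq_eLpNorm_entire]
  exact norm_le_exp_mul _ (differentiable_entire f) (memLp_entire f) z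

theorem inner_eq_integral (f g : FockSpace) :
    inner ℂ f g = ∫ w, starRingEnd ℂ (entire f w) * entire g w ∂gaussian := by
  change inner ℂ (toL2 f) (toL2 g) = _
  rw [L2.inner_def]
  refine integral_congr_ae ?_
  filter_upwards [toL2_ae_entire f, toL2_ae_entire g] with w h1 h2
  rw [h1, h2, RCLike.inner_apply, mul_comm]

theorem norm_sq_eq_lintegral (f : FockSpace) :
    ENNReal.ofReal (‖f‖ ^ 2) = ∫⁻ w, ‖entire f w‖ₑ ^ 2 ∂gaussian := by
  rw [← eLpNorm_two_sq, norm_eq_eLpNorm_entire, ENNReal.ofReal_pow ENNReal.toReal_nonneg,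
    ENNReal.ofReal_toReal (memLp_entire f).2.ne]

/-- A functional of norm at most one that takes the value one at a unit vector is the inner
product with this vector. -/
theorem eq_inner_of_norm_le_one {E : Type*} [NormedAddCommGroup E] [InnerProductSpace ℂ E]
    [CompleteSpace E] (l : E →L[ℂ] ℂ) (hl : ‖l‖ ≤ 1) (e : E) (he : ‖e‖ = 1) (h : l e = 1)
    (f : E) : l f = inner ℂ e f := by
  obtain ⟨v, rfl⟩ := (InnerProductSpace.toDual ℂ E).surjective l
  rw [LinearIsometryEquiv.norm_map] at hl
  rw [InnerProductSpace.toDual_apply_apply] at h ⊢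
  -- Equality case of Cauchy–Schwarz: `‖v - e‖² = ‖v‖² - 2 + 1` with `‖v‖ ≤ 1`.
  have : ‖v - e‖ ^ 2 ≤ 0 := by
    rw [norm_sub_sq (𝕜 := ℂ), h, he]
    simp
    nlinarith [norm_nonneg v]
  have : v - e = 0 := by
    rw [← norm_eq_zero]; nlinarith [norm_nonneg (v - e)]
  rw [sub_eq_zero.1 this]

/-- Evaluation at `z`, scaled by `exp(-|z|²/2)`, has norm at most one by the pointwise bound and
equals one at the unit vector `k_z`. Its Riesz representative must therefore be `k_z`; no
orthonormal basis or kernel expansion is needed. -/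
theorem inner_kvec (z : ℂ) (f : FockSpace) :
    inner ℂ (kvec z) f = (Real.exp (-(‖z‖ ^ 2 / 2)) : ℂ) * entire f z := by
  let l : FockSpace →L[ℂ] ℂ := LinearMap.mkContinuous
    { toFun := fun f => (Real.exp (-(‖z‖ ^ 2 / 2)) : ℂ) * entire f z
      map_add' := fun f g => by simp only [entire_add, Pi.add_apply]; ring
      map_smul' := fun c f => by
        simp only [entire_smul, Pi.smul_apply, smul_eq_mul, RingHom.id_apply]; ring } 1
    fun f => by
      have := norm_entire_le f z
      simp only [LinearMap.coe_mk, AddHom.coe_mk, norm_mul, one_mul]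
      rw [Complex.norm_real, Real.norm_of_nonneg (Real.exp_pos _).le, Real.exp_neg,
        inv_mul_le_iff₀ (Real.exp_pos _)]
      exact this
  refine (eq_inner_of_norm_le_one l (LinearMap.mkContinuous_norm_le _ zero_le_one _) (kvec z)
    (norm_kvec z) ?_ f).symm
  change (Real.exp (-(‖z‖ ^ 2 / 2)) : ℂ) * entire (kvec z) z = 1
  rw [entire_kvec, kernel, Complex.ofReal_exp, ← Complex.exp_add, Complex.mul_conj,
    Complex.normSq_eq_norm_sq, Complex.exp_eq_one_iff]
  refine ⟨0, ?_⟩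
  push_cast
  ring

theorem entire_eq_inner (f : FockSpace) (z : ℂ) :
    entire f z = (Real.exp (‖z‖ ^ 2 / 2) : ℂ) * inner ℂ (kvec z) f := by
  rw [inner_kvec, ← mul_assoc, ← Complex.ofReal_mul, ← Real.exp_add]
  simp

/-- A function orthogonal to every kernel vanishes at every point. -/
theorem dense_span_kvec : (Submodule.span ℂ (Set.range kvec)).topologicalClosure = ⊤ := by
  rw [Submodule.topologicalClosure_eq_top_iff, Submodule.eq_bot_iff]
  intro f hf
  refine entire_injective ?_
  funext z
  rw [entire_eq_inner, entire_eq_inner,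
    (Submodule.mem_orthogonal _ f).1 hf (kvec z) (Submodule.subset_span ⟨z, rfl⟩), inner_zero_right]

theorem inner_toeplitz {F : ℂ → ℂ} (hF : MemLp F ∞ gaussian) (g h : FockSpace) :
    inner ℂ h (toeplitz (hF.toLp F) g) =
      ∫ w, starRingEnd ℂ (entire h w) * (F w * entire g w) ∂gaussian := by
  have e : inner ℂ h (toeplitz (hF.toLp F) g) = inner ℂ (toL2 h)
      ((ContinuousLinearMap.mul ℂ ℂ).holder 2 (hF.toLp F) (toL2 g)) :=
    Submodule.inner_orthogonalProjectionOnto_eq_of_mem_left (K := fockSubmodule) h _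
  rw [e, L2.inner_def]
  refine integral_congr_ae ?_
  filter_upwards [toL2_ae_entire h, toL2_ae_entire g, hF.coeFn_toLp,
    (ContinuousLinearMap.mul ℂ ℂ).coeFn_holder (r := 2) (hF.toLp F) (toL2 g)] with w h1 h2 h3 h4
  rw [h4, h1, h2, h3, RCLike.inner_apply, mul_comm]
  rfl

theorem toeplitz_mem (f : Lp ℂ ∞ gaussian) : toeplitz f ∈ toeplitzAlgebra :=
  StarSubalgebra.le_topologicalClosure _ (StarAlgebra.subset_adjoin ℂ _ ⟨f, rfl⟩)

theorem isClosed_toeplitzAlgebra :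
    IsClosed (toeplitzAlgebra : Set (FockSpace →L[ℂ] FockSpace)) :=
  StarSubalgebra.isClosed_topologicalClosure _

/-- An operator is determined by its matrix elements between reproducing kernels. -/
theorem ext_kvec {A B : FockSpace →L[ℂ] FockSpace}
    (h : ∀ z w, inner ℂ (kvec w) (A (kvec z)) = inner ℂ (kvec w) (B (kvec z))) : A = B := by
  refine ContinuousLinearMap.ext_on (s := Set.range kvec) ?_ ?_
  · rw [Submodule.dense_iff_topologicalClosure_eq_top]
    exact dense_span_kvec
  · rintro _ ⟨z, rfl⟩
    refine entire_injective (funext fun w => ?_)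
    rw [entire_eq_inner, entire_eq_inner, h]

/-! ### Gaussian off-diagonal decay of matrix elements -/

theorem integrable_exp_neg_mul_norm_sq {b : ℝ} (hb : 0 < b) :
    Integrable fun u : ℂ => Real.exp (-b * ‖u‖ ^ 2) := by
  by_contra hc
  have h := GaussianFourier.integral_rexp_neg_mul_sq_norm (V := ℂ) hb
  rw [integral_undef hc] at h
  have : 0 < (π / b) ^ ((Module.finrank ℝ ℂ : ℝ) / 2) := by positivity
  exact this.ne h

theorem integral_gaussian (F : ℂ → ℂ) :
    ∫ u, F u ∂gaussian = ∫ u, (π⁻¹ * Real.exp (-‖u‖ ^ 2)) • F u := by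
  rw [gaussian, integral_withDensity_eq_integral_toReal_smul measurable_density
    (ae_of_all _ fun _ => ENNReal.ofReal_lt_top)]
  refine integral_congr_ae (ae_of_all _ fun u => ?_)
  simp only
  rw [ENNReal.toReal_ofReal (by positivity)]

/-- Pairing two functions concentrated near `z` and near `w`. -/
theorem norm_integral_le_of_localized {δ : ℝ} (hδ : 0 < δ) :
    ∃ K : ℝ, 0 ≤ K ∧ ∀ (F G : ℂ → ℂ) (C D : ℝ) (z w : ℂ), 0 ≤ C → 0 ≤ D →
      (∀ᵐ u ∂gaussian, ‖F u‖ ≤ C * Real.exp (‖u‖ ^ 2 / 2 - δ * ‖u - z‖ ^ 2)) →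
      (∀ᵐ u ∂gaussian, ‖G u‖ ≤ D * Real.exp (‖u‖ ^ 2 / 2 - δ * ‖u - w‖ ^ 2)) →
      ‖∫ u, starRingEnd ℂ (F u) * G u ∂gaussian‖ ≤
        C * D * K * Real.exp (-(δ / 4) * ‖z - w‖ ^ 2) := by
  have hint := integrable_exp_neg_mul_norm_sq (half_pos hδ)
  refine ⟨∫ u : ℂ, π⁻¹ * Real.exp (-(δ / 2) * ‖u‖ ^ 2),
    integral_nonneg fun u => by positivity, fun F G C D z w hC hD hF hG => ?_⟩
  have hint' : Integrable fun u : ℂ =>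
      C * D * Real.exp (-(δ / 4) * ‖z - w‖ ^ 2) * (π⁻¹ * Real.exp (-(δ / 2) * ‖u - z‖ ^ 2)) :=
    ((hint.comp_sub_right z).const_mul _).const_mul _
  rw [integral_gaussian]
  refine (norm_integral_le_of_norm_le hint' ?_).trans (le_of_eq ?_)
  · filter_upwards [volume_absolutelyContinuous.ae_le hF,
      volume_absolutelyContinuous.ae_le hG] with u h1 h2
    rw [norm_smul, norm_mul (starRingEnd ℂ (F u)), RCLike.norm_conj,
      Real.norm_of_nonneg (by positivity)]
    refine (mul_le_mul_of_nonneg_left (mul_le_mul h1 h2 (norm_nonneg _) (by positivity))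
      (by positivity)).trans ?_
    have ht : ‖z - w‖ ≤ ‖u - z‖ + ‖u - w‖ := by
      have := norm_sub_le (u - w) (u - z)
      rw [show u - w - (u - z) = z - w by ring] at this
      linarith
    -- The two growth factors cancel the Gaussian density. Half of the remaining exponent yields the
    -- decay in `|z - w|` through `|z - w|² ≤ 2|u - z|² + 2|u - w|²`; the other half, around `z`,
    -- keeps the integral finite uniformly in `z`.
    have e : Real.exp (-‖u‖ ^ 2) * (Real.exp (‖u‖ ^ 2 / 2 - δ * ‖u - z‖ ^ 2) *
        Real.exp (‖u‖ ^ 2 / 2 - δ * ‖u - w‖ ^ 2)) ≤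
        Real.exp (-(δ / 4) * ‖z - w‖ ^ 2) * Real.exp (-(δ / 2) * ‖u - z‖ ^ 2) := by
      rw [← Real.exp_add, ← Real.exp_add, ← Real.exp_add, Real.exp_le_exp]
      have h3 : ‖z - w‖ ^ 2 ≤ 2 * ‖u - z‖ ^ 2 + 2 * ‖u - w‖ ^ 2 := by
        nlinarith [norm_nonneg (z - w), sq_nonneg (‖u - z‖ - ‖u - w‖)]
      nlinarith [mul_le_mul_of_nonneg_left h3 hδ.le, mul_nonneg hδ.le (sq_nonneg ‖u - w‖)]
    calc _ = π⁻¹ * C * D * (Real.exp (-‖u‖ ^ 2) * (Real.exp (‖u‖ ^ 2 / 2 - δ * ‖u - z‖ ^ 2) *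
        Real.exp (‖u‖ ^ 2 / 2 - δ * ‖u - w‖ ^ 2))) := by ring
      _ ≤ π⁻¹ * C * D * (Real.exp (-(δ / 4) * ‖z - w‖ ^ 2) *
        Real.exp (-(δ / 2) * ‖u - z‖ ^ 2)) := by gcongr
      _ = _ := by ring
  · rw [integral_const_mul,
      integral_sub_right_eq_self (fun u : ℂ => π⁻¹ * Real.exp (-(δ / 2) * ‖u‖ ^ 2)) z]
    ring

/-- The matrix elements of the operator between reproducing kernels have Gaussian off-diagonal
decay. -/
def HasGaussianDecay (A : FockSpace →L[ℂ] FockSpace) : Prop :=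
  ∃ C δ : ℝ, 0 ≤ C ∧ 0 < δ ∧ ∀ z w,
    ‖(inner ℂ (kvec w) (A (kvec z)) : ℂ)‖ ≤ C * Real.exp (-δ * ‖z - w‖ ^ 2)

theorem norm_entire_kvec (z u : ℂ) :
    ‖entire (kvec z) u‖ = Real.exp (‖u‖ ^ 2 / 2 - 1 / 2 * ‖u - z‖ ^ 2) := by
  rw [entire_kvec, norm_kernel]
  congr 1
  ring

theorem ae_norm_le_norm (f : Lp ℂ ∞ gaussian) : ∀ᵐ u ∂gaussian, ‖f u‖ ≤ ‖f‖ := by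
  filter_upwards [ae_le_eLpNormEssSup (f := f) (μ := gaussian)] with u hu
  rw [Lp.norm_def, eLpNorm_exponent_top, ← toReal_enorm]
  refine ENNReal.toReal_mono ?_ hu
  rw [← eLpNorm_exponent_top]
  exact (Lp.memLp f).2.ne

/-- Kernels are localized with `δ = 1/2` exactly, since `|k_z(u)| = exp(|u|²/2 - |u - z|²/2)`; a
bounded symbol only costs its norm. -/
theorem hasGaussianDecay_toeplitz (f : Lp ℂ ∞ gaussian) : HasGaussianDecay (toeplitz f) := by
  obtain ⟨K, hK, h⟩ := norm_integral_le_of_localized (δ := 1 / 2) (by norm_num)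
  have hf := Lp.memLp f
  refine ⟨1 * ‖f‖ * K, 1 / 2 / 4, by positivity, by norm_num, fun z w => ?_⟩
  have e : f = hf.toLp f := (Lp.toLp_coeFn f hf).symm
  rw [e, inner_toeplitz, ← e, norm_sub_rev]
  refine h _ (fun u => f u * entire (kvec z) u) 1 ‖f‖ w z zero_le_one (norm_nonneg _)
    (ae_of_all _ fun u => ?_) ?_
  · rw [norm_entire_kvec, one_mul]
  · filter_upwards [ae_norm_le_norm f] with u hu
    rw [norm_mul, norm_entire_kvec]
    gcongr

theorem HasGaussianDecay.adjoint {A : FockSpace →L[ℂ] FockSpace} (hA : HasGaussianDecay A) :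
    HasGaussianDecay (ContinuousLinearMap.adjoint A) := by
  obtain ⟨C, δ, hC, hδ, h⟩ := hA
  refine ⟨C, δ, hC, hδ, fun z w => ?_⟩
  rw [ContinuousLinearMap.adjoint_inner_right, norm_inner_symm, norm_sub_rev]
  exact h w z

theorem HasGaussianDecay.mono {A : FockSpace →L[ℂ] FockSpace} {C δ δ' : ℝ} (hC : 0 ≤ C)
    (hδ : δ' ≤ δ)
    (h : ∀ z w, ‖(inner ℂ (kvec w) (A (kvec z)) : ℂ)‖ ≤ C * Real.exp (-δ * ‖z - w‖ ^ 2))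
    (z w : ℂ) : ‖(inner ℂ (kvec w) (A (kvec z)) : ℂ)‖ ≤ C * Real.exp (-δ' * ‖z - w‖ ^ 2) :=
  (h z w).trans (by gcongr)

theorem HasGaussianDecay.add {A B : FockSpace →L[ℂ] FockSpace} (hA : HasGaussianDecay A)
    (hB : HasGaussianDecay B) : HasGaussianDecay (A + B) := by
  obtain ⟨C, δ, hC, hδ, h⟩ := hA
  obtain ⟨D, ε, hD, hε, h'⟩ := hB
  refine ⟨C + D, min δ ε, by positivity, lt_min hδ hε, fun z w => ?_⟩
  rw [add_apply, inner_add_right, add_mul]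
  exact (norm_add_le _ _).trans (add_le_add (mono hC (min_le_left _ _) h z w)
    (mono hD (min_le_right _ _) h' z w))

/-- Evaluation at `u` is, up to the factor `exp(|u|²/2)`, the matrix element against `k_u`, so decay
of matrix elements is pointwise localization of `A k_z` near `z`. -/
theorem norm_entire_le_of_decay {A : FockSpace →L[ℂ] FockSpace} {C δ : ℝ}
    (h : ∀ z w, ‖(inner ℂ (kvec w) (A (kvec z)) : ℂ)‖ ≤ C * Real.exp (-δ * ‖z - w‖ ^ 2))
    (z u : ℂ) :
    ‖entire (A (kvec z)) u‖ ≤ C * Real.exp (‖u‖ ^ 2 / 2 - δ * ‖u - z‖ ^ 2) := by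
  rw [entire_eq_inner, norm_mul, Complex.norm_real, Real.norm_of_nonneg (Real.exp_pos _).le]
  refine (mul_le_mul_of_nonneg_left (h z u) (Real.exp_pos _).le).trans (le_of_eq ?_)
  rw [mul_left_comm, ← Real.exp_add, norm_sub_rev z u]
  congr 2
  ring

/-- In `⟨k_w, AB k_z⟩ = ⟨A* k_w, B k_z⟩` the two vectors are localized near `w` and `z`, so the
pairing estimate applies. -/
theorem HasGaussianDecay.mul {A B : FockSpace →L[ℂ] FockSpace} (hA : HasGaussianDecay A)
    (hB : HasGaussianDecay B) : HasGaussianDecay (A * B) := by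
  obtain ⟨C, δ, hC, hδ, h⟩ := hA.adjoint
  obtain ⟨D, ε, hD, hε, h'⟩ := hB
  have hm := lt_min hδ hε
  obtain ⟨K, hK, hint⟩ := norm_integral_le_of_localized hm
  refine ⟨C * D * K, min δ ε / 4, by positivity, by positivity, fun z w => ?_⟩
  rw [mul_apply_eq_comp, ← ContinuousLinearMap.adjoint_inner_left, inner_eq_integral,
    norm_sub_rev]
  exact hint _ _ C D w z hC hD
    (ae_of_all _ (norm_entire_le_of_decay (mono hC (min_le_left _ _) h) w))
    (ae_of_all _ (norm_entire_le_of_decay (mono hD (min_le_right _ _) h') z))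

theorem norm_inner_kvec_kvec (z w : ℂ) :
    ‖(inner ℂ (kvec w) (kvec z) : ℂ)‖ = Real.exp (-(1 / 2) * ‖z - w‖ ^ 2) := by
  rw [inner_kvec, norm_mul, Complex.norm_real, Real.norm_of_nonneg (Real.exp_pos _).le,
    norm_entire_kvec, ← Real.exp_add, norm_sub_rev z w]
  congr 1
  ring

theorem hasGaussianDecay_algebraMap (r : ℂ) :
    HasGaussianDecay (algebraMap ℂ (FockSpace →L[ℂ] FockSpace) r) := by
  refine ⟨‖r‖, 1 / 2, norm_nonneg _, by norm_num, fun z w => ?_⟩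
  rw [Algebra.algebraMap_eq_smul_one, smul_apply,
    one_apply_eq_self, inner_smul_right, norm_mul, norm_inner_kvec_kvec]

theorem hasGaussianDecay_of_mem_adjoin {A : FockSpace →L[ℂ] FockSpace}
    (hA : A ∈ StarAlgebra.adjoin ℂ (Set.range toeplitz)) : HasGaussianDecay A := by
  induction hA using StarAlgebra.adjoin_induction with
  | mem x hx =>
    obtain ⟨f, rfl⟩ := hx
    exact hasGaussianDecay_toeplitz f
  | algebraMap r => exact hasGaussianDecay_algebraMap r
  | add x y _ _ hx hy => exact hx.add hy
  | mul x y _ _ hx hy => exact hx.mul hy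
  | star x _ hx => exact hx.adjoint

/-- Matrix elements of operators in the Toeplitz algebra vanish uniformly off the diagonal. -/
theorem exists_norm_inner_lt_of_mem {A : FockSpace →L[ℂ] FockSpace} (hA : A ∈ toeplitzAlgebra)
    {ε : ℝ} (hε : 0 < ε) : ∃ R : ℝ, ∀ z w, R ≤ ‖z - w‖ →
      ‖(inner ℂ (kvec w) (A (kvec z)) : ℂ)‖ < ε := by
  have hA' : A ∈ closure (StarAlgebra.adjoin ℂ (Set.range toeplitz) :
      Set (FockSpace →L[ℂ] FockSpace)) := hA
  obtain ⟨B, hB, hAB⟩ := Metric.mem_closure_iff.1 hA' (ε / 2) (half_pos hε)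
  obtain ⟨C, δ, hC, hδ, h⟩ := hasGaussianDecay_of_mem_adjoin hB
  have ht : Tendsto (fun r : ℝ => C * Real.exp (-δ * r ^ 2)) atTop (𝓝 0) := by
    have h1 : Tendsto (fun r : ℝ => δ * r ^ 2) atTop atTop :=
      (tendsto_pow_atTop two_ne_zero).const_mul_atTop hδ
    have := (Real.tendsto_exp_neg_atTop_nhds_zero.comp h1).const_mul C
    simpa [Function.comp_def] using this
  obtain ⟨R, hR⟩ := eventually_atTop.1 (ht.eventually_lt_const (half_pos hε))
  refine ⟨R, fun z w hzw => ?_⟩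
  have e : (inner ℂ (kvec w) (A (kvec z)) : ℂ) =
      inner ℂ (kvec w) ((A - B) (kvec z)) + inner ℂ (kvec w) (B (kvec z)) := by
    rw [← inner_add_right, sub_apply, sub_add_cancel]
  have h1 : ‖(inner ℂ (kvec w) ((A - B) (kvec z)) : ℂ)‖ ≤ ‖A - B‖ := by
    refine (norm_inner_le_norm _ _).trans ?_
    rw [norm_kvec, one_mul]
    simpa [norm_kvec] using (A - B).le_opNorm (kvec z)
  rw [dist_eq_norm] at hAB
  rw [e]
  have := norm_add_le (inner ℂ (kvec w) ((A - B) (kvec z)) : ℂ) (inner ℂ (kvec w) (B (kvec z)))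
  linarith [h z w, hR _ hzw]

/-! ### Unnormalized kernels and Weyl operators -/

/-- The reproducing kernel `w ↦ exp (w * conj z)` as an element of the Fock space. -/
def repr (z : ℂ) : FockSpace := (Real.exp (‖z‖ ^ 2 / 2) : ℂ) • kvec z

theorem inner_repr (z : ℂ) (f : FockSpace) : inner ℂ (repr z) f = entire f z := by
  rw [repr, inner_smul_left, Complex.conj_ofReal, entire_eq_inner]

theorem entire_repr (z w : ℂ) : entire (repr z) w = Complex.exp (w * starRingEnd ℂ z) := by
  rw [repr, entire_smul, Pi.smul_apply, entire_kvec, smul_eq_mul, kernel, Complex.ofReal_exp,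
    ← Complex.exp_add]
  congr 1
  push_cast
  ring

theorem repr_zero : repr 0 = kvec 0 := by simp [repr]

theorem norm_repr_sub_sq (z w : ℂ) : ‖repr z - repr w‖ ^ 2 =
    Real.exp (‖z‖ ^ 2) - 2 * (Complex.exp (z * starRingEnd ℂ w)).re + Real.exp (‖w‖ ^ 2) := by
  have h : ∀ z, ‖repr z‖ ^ 2 = Real.exp (‖z‖ ^ 2) := fun z => by
    rw [repr, norm_smul, norm_kvec, mul_one, Complex.norm_real,
      Real.norm_of_nonneg (Real.exp_pos _).le, ← Real.exp_nat_mul]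
    congr 1
    push_cast
    ring
  rw [norm_sub_sq (𝕜 := ℂ), h, h, inner_repr, entire_repr]
  rfl

/-- The distance from `repr z` to `repr w` is an explicit continuous function of `z` that vanishes
at `z = w`. -/
theorem continuous_repr : Continuous repr := by
  refine continuous_iff_continuousAt.2 fun w => tendsto_iff_norm_sub_tendsto_zero.2 ?_
  have hc : Continuous fun z => √(Real.exp (‖z‖ ^ 2) -
      2 * (Complex.exp (z * starRingEnd ℂ w)).re + Real.exp (‖w‖ ^ 2)) := by fun_prop
  have h0 := hc.tendsto w
  simp only [← norm_repr_sub_sq, Real.sqrt_sq (norm_nonneg _), sub_self, norm_zero,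
    ne_eq, OfNat.ofNat_ne_zero, not_false_eq_true, zero_pow, Real.sqrt_zero] at h0
  exact h0

theorem ext_repr {A B : FockSpace →L[ℂ] FockSpace}
    (h : ∀ z w, entire (A (repr z)) w = entire (B (repr z)) w) : A = B := by
  have e : ∀ z, kvec z = (Real.exp (‖z‖ ^ 2 / 2) : ℂ)⁻¹ • repr z := fun z => by
    rw [repr, smul_smul, inv_mul_cancel₀ (by exact_mod_cast (Real.exp_pos _).ne'), one_smul]
  refine ext_kvec fun z w => ?_
  rw [e z, map_smul, map_smul, inner_kvec, inner_kvec, entire_smul, entire_smul, Pi.smul_apply,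
    Pi.smul_apply, h]

theorem memLp_top_of_norm_le {F : ℂ → ℂ} (hF : Measurable F) (C : ℝ) (h : ∀ z, ‖F z‖ ≤ C) :
    MemLp F ∞ gaussian :=
  memLp_top_of_bound hF.aestronglyMeasurable C (ae_of_all _ h)

/-- Weyl operators are multiples of Toeplitz operators with unimodular symbols. -/
theorem weyl_mem (z : ℂ) : weyl z ∈ toeplitzAlgebra := by
  let F : ℂ → ℂ := fun u => Complex.exp (u * starRingEnd ℂ z - starRingEnd ℂ u * z)
  have hF : MemLp F ∞ gaussian := by
    refine memLp_top_of_norm_le (by fun_prop) 1 fun u => le_of_eq ?_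
    rw [Complex.norm_exp, Real.exp_eq_one_iff]
    simp [mul_comm]
  have e : weyl z = (Real.exp (‖z‖ ^ 2 / 2) : ℂ) • toeplitz (hF.toLp F) := by
    refine ext_repr fun v w => ?_
    rw [smul_apply, entire_smul, Pi.smul_apply, ← inner_repr w (toeplitz _ _), inner_toeplitz,
      entire_weyl, entire_repr]
    -- The holomorphic factor of the symbol shifts the kernel at `v` to `v + z`, the antiholomorphic
    -- one shifts the conjugated kernel at `w` to `w - z`; the integral becomes an inner product of
    -- two kernels.
    have : ∀ u, starRingEnd ℂ (entire (repr w) u) * (F u * entire (repr v) u) =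
        starRingEnd ℂ (entire (repr (w - z)) u) * entire (repr (v + z)) u := by
      intro u
      simp only [entire_repr, F, ← Complex.exp_conj, ← Complex.exp_add]
      congr 1
      simp only [map_mul, map_sub, map_add, Complex.conj_conj]
      ring
    simp only [this]
    rw [← inner_eq_integral, inner_repr, entire_repr, smul_eq_mul, Complex.ofReal_exp,
      ← Complex.exp_add, kernel, ← Complex.exp_add]
    congr 1
    push_cast
    rw [map_add]
    linear_combination Complex.mul_conj' z
  rw [e]
  exact toeplitzAlgebra.smul_mem (toeplitz_mem _) _

/-! ### Compact operators in the Toeplitz algebra -/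

open InnerProductSpace in
theorem continuous_rankOne {X E : Type*} [TopologicalSpace X] [NormedAddCommGroup E]
    [InnerProductSpace ℂ E] {u v : X → E} (hu : Continuous u) (hv : Continuous v) :
    Continuous fun x => rankOne ℂ (u x) (v x) :=
  ((ContinuousLinearMap.smulRightL ℂ E E).continuous.comp
    ((innerSL ℂ).continuous.comp hv)).clm_apply hu

open InnerProductSpace in
/-- The projection onto the constants is a limit of Toeplitz operators whose symbols are normalized
indicators of small balls. -/
theorem rankOne_kvec_zero_mem : rankOne ℂ (kvec 0) (kvec 0) ∈ toeplitzAlgebra := by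
  rw [← repr_zero]
  refine isClosed_toeplitzAlgebra.closure_subset (Metric.mem_closure_iff.2 fun ε hε => ?_)
  have hc : Continuous fun w => rankOne ℂ (repr w) (repr w) :=
    continuous_rankOne continuous_repr continuous_repr
  obtain ⟨r, hr, hball⟩ := Metric.continuous_iff.1 hc 0 (ε / 2) (half_pos hε)
  set s : Set ℂ := Metric.ball 0 r
  have hs : MeasurableSet s := measurableSet_ball
  have hm : gaussian.real s ≠ 0 := by
    rw [measureReal_ne_zero_iff]
    intro h
    exact (Metric.measure_ball_pos volume (0 : ℂ) hr).ne' (volume_absolutelyContinuous h)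
  have hF : MemLp (s.indicator fun _ => ((gaussian.real s)⁻¹ : ℂ)) ∞ gaussian :=
    (memLp_const _).indicator hs
  refine ⟨_, toeplitz_mem (hF.toLp _), ?_⟩
  rw [dist_comm, dist_eq_norm]
  refine lt_of_le_of_lt (ContinuousLinearMap.opNorm_le_bound _ (half_pos hε).le fun g => ?_)
    (half_lt_self hε)
  set h : FockSpace := (toeplitz (hF.toLp _) - rankOne ℂ (repr 0) (repr 0)) g with hh
  have hr1 : ∀ w, inner ℂ h (rankOne ℂ (repr w) (repr w) g) =
      starRingEnd ℂ (entire h w) * entire g w := fun w => by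
    rw [rankOne_apply, inner_smul_right, inner_repr, ← inner_conj_symm, inner_repr, mul_comm]
  have hint : IntegrableOn (fun w => starRingEnd ℂ (entire h w) * entire g w) s gaussian := by
    refine IntegrableOn.mono_set ?_ Metric.ball_subset_closedBall
    refine ContinuousOn.integrableOn_compact (isCompact_closedBall 0 r) ?_
    have h1 := (differentiable_entire h).continuous
    have h2 := (differentiable_entire g).continuous
    fun_prop
  -- The Toeplitz operator is the average over the ball of the rank-one operators `repr w ⊗ repr w`,
  -- which are norm-close to the one at `0`. Testing against `h` itself turns this into a scalar
  -- integral bounding `‖h‖²`.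
  have key : (inner ℂ h h : ℂ) = ((gaussian.real s)⁻¹ : ℂ) * ∫ w in s,
      inner ℂ h ((rankOne ℂ (repr w) (repr w) - rankOne ℂ (repr 0) (repr 0)) g) ∂gaussian := by
    nth_rw 2 [hh]
    simp only [sub_apply, inner_sub_right, hr1]
    rw [integral_sub hint (integrable_const _), integral_const, inner_toeplitz, mul_sub]
    congr 1
    · rw [← integral_const_mul, ← integral_indicator hs]
      refine integral_congr_ae (ae_of_all _ fun w => ?_)
      by_cases hw : w ∈ s <;> simp [hw]
      ring
    · rw [measureReal_restrict_apply_univ, Complex.real_smul, inv_mul_cancel_left₀]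
      exact_mod_cast hm
  have hle : ‖h‖ ^ 2 ≤ ε / 2 * ‖g‖ * ‖h‖ := by
    have h1 := congrArg norm key
    rw [inner_self_eq_norm_sq_to_K, norm_mul, norm_inv, Complex.norm_real,
      Real.norm_of_nonneg measureReal_nonneg] at h1
    have h2 := norm_setIntegral_le_of_norm_le_const (μ := gaussian) (s := s)
      (f := fun w => (inner ℂ h ((rankOne ℂ (repr w) (repr w) - rankOne ℂ (repr 0) (repr 0)) g) : ℂ))
      (C := ‖h‖ * (ε / 2 * ‖g‖)) (measure_lt_top _ _) fun w hw => by
        refine (norm_inner_le_norm _ _).trans ?_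
        gcongr
        refine (ContinuousLinearMap.le_opNorm _ _).trans ?_
        gcongr
        rw [← dist_eq_norm]
        exact (hball w hw).le
    have h3 : ‖h‖ ^ 2 = (gaussian.real s)⁻¹ * ‖∫ w in s, (inner ℂ h
        ((rankOne ℂ (repr w) (repr w) - rankOne ℂ (repr 0) (repr 0)) g) : ℂ) ∂gaussian‖ := by
      rw [← h1]; simp
    rw [h3, inv_mul_le_iff₀ (lt_of_le_of_ne measureReal_nonneg hm.symm)]
    refine h2.trans (le_of_eq ?_)
    ring
  by_contra hcon
  push Not at hcon
  have : 0 ≤ ε / 2 * ‖g‖ := by positivity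
  nlinarith

theorem weyl_kvec_zero (a : ℂ) : weyl a (kvec 0) = kvec a := by
  refine entire_injective (funext fun w => ?_)
  rw [entire_weyl, entire_kvec, entire_kvec]
  simp [kernel]

open InnerProductSpace in
-- Conjugating the projection onto constants by Weyl operators gives `W_a (k_0 ⊗ k_0) W_b* = k_a ⊗
-- k_b`. Density of the kernels extends this in the first slot, and taking adjoints carries it over
-- to the second.
theorem rankOne_mem (x y : FockSpace) : rankOne ℂ x y ∈ toeplitzAlgebra := by
  have h0 : ∀ a b, rankOne ℂ (kvec a) (kvec b) ∈ toeplitzAlgebra := fun a b => by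
    have := mul_mem (mul_mem (weyl_mem a) rankOne_kvec_zero_mem) (star_mem (weyl_mem b))
    rwa [ContinuousLinearMap.mul_def, ContinuousLinearMap.mul_def, comp_rankOne, rankOne_comp,
      ContinuousLinearMap.star_eq_adjoint, ContinuousLinearMap.adjoint_adjoint, weyl_kvec_zero,
      weyl_kvec_zero] at this
  have h1 : ∀ y : FockSpace, (∀ a, rankOne ℂ (kvec a) y ∈ toeplitzAlgebra) →
      ∀ x, rankOne ℂ x y ∈ toeplitzAlgebra := fun y hy x => by
    let S : Submodule ℂ FockSpace :=
      { carrier := {x | rankOne ℂ x y ∈ toeplitzAlgebra}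
        add_mem' := fun {u v} hu hv => by
          simp only [Set.mem_ofPred_eq, map_add, add_apply] at *
          exact add_mem hu hv
        zero_mem' := by simp [zero_mem]
        smul_mem' := fun c u hu => by
          simp only [Set.mem_ofPred_eq, map_smul, smul_apply] at *
          exact toeplitzAlgebra.smul_mem hu c }
    have hS : IsClosed (S : Set FockSpace) :=
      isClosed_toeplitzAlgebra.preimage  (continuous_rankOne continuous_id continuous_const)
    have := Submodule.topologicalClosure_minimal (Submodule.span ℂ (Set.range kvec)) (t := S)
      (Submodule.span_le.2 (by rintro _ ⟨a, rfl⟩; exact hy a)) hS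
    rw [dense_span_kvec] at this
    exact this Submodule.mem_top
  refine h1 y (fun a => ?_) x
  have := star_mem (h1 (kvec a) (fun b => h0 b a) y)
  rwa [ContinuousLinearMap.star_eq_adjoint, adjoint_rankOne] at this

/-- Compact operators belong to the Toeplitz algebra. -/
theorem mem_toeplitzAlgebra_of_isCompactOperator {A : FockSpace →L[ℂ] FockSpace}
    (hA : IsCompactOperator A) : A ∈ toeplitzAlgebra := by
  refine isClosed_toeplitzAlgebra.closure_subset (Metric.mem_closure_iff.2 fun ε hε => ?_)
  obtain ⟨K, hK, hAK⟩ :=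
    IsCompactOperator.image_closedBall_subset_compact (f := (A : FockSpace →ₗ[ℂ] FockSpace)) hA 1
  obtain ⟨t, ht, hKt⟩ := Metric.totallyBounded_iff.1 hK.totallyBounded (ε / 2) (half_pos hε)
  let S := Submodule.span ℂ t
  have : FiniteDimensional ℂ S := FiniteDimensional.span_of_finite ℂ ht
  refine ⟨S.starProjection ∘L A, ?_, ?_⟩
  · rw [(stdOrthonormalBasis ℂ S).starProjection_eq_sum_rankOne, ContinuousLinearMap.finsetSum_comp]
    refine sum_mem fun i _ => ?_
    rw [InnerProductSpace.rankOne_comp]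
    exact rankOne_mem _ _
  · rw [dist_eq_norm]
    refine lt_of_le_of_lt (ContinuousLinearMap.opNorm_le_of_re_inner_le (half_pos hε).le
      fun x y hx hy => ?_) (half_lt_self hε)
    obtain ⟨v, hv, hxv⟩ := Set.mem_iUnion₂.1 (hKt (hAK ⟨x, by simp [hx], rfl⟩))
    -- The net point `v` lies in `S`, so it may be subtracted before projecting onto the orthogonal
    -- complement.
    have h2 : (A - S.starProjection ∘L A) x = Sᗮ.starProjection (A x - v) := by
      rw [map_sub, Submodule.starProjection_orthogonal_val, Submodule.starProjection_orthogonal_val,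
        Submodule.starProjection_eq_self_iff.2 (Submodule.subset_span hv)]
      simp
    refine (Complex.re_le_norm _).trans ((norm_inner_le_norm _ _).trans ?_)
    rw [hy, mul_one, h2]
    refine (Submodule.norm_starProjection_apply_le _ _).trans ?_
    rw [← dist_eq_norm]
    exact (Metric.mem_ball.1 hxv).le

/-! ### Boundedness forces an affine symbol -/

/-- A consequence of Jensen's formula: the circle averages of `log |ψ|` are bounded below. -/
theorem exists_le_circleAverage_log_norm {ψ : ℂ → ℂ} (hψ : Differentiable ℂ ψ) :
    ∃ L : ℝ, ∀ r : ℝ, 1 ≤ r → L ≤ Real.circleAverage (fun z => Real.log ‖ψ z‖) 0 r := by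
  refine ⟨Real.log ‖meromorphicTrailingCoeffAt ψ 0‖, fun r hr => ?_⟩
  have ha : AnalyticOnNhd ℂ ψ (Metric.closedBall 0 |r|) := fun z _ => hψ.analyticAt z
  have hD : ∀ u, (0 : ℝ) ≤ MeromorphicOn.divisor ψ (Metric.closedBall 0 |r|) u := fun u =>
    mod_cast MeromorphicOn.AnalyticOnNhd.divisor_nonneg ha u
  rw [MeromorphicOn.circleAverage_log_norm (by positivity) ha.meromorphicOn]
  refine le_add_of_nonneg_left (add_nonneg (finsum_nonneg fun u => ?_)
    (mul_nonneg (hD _) (Real.log_nonneg hr)))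
  by_cases hu : u ∈ Metric.closedBall (0 : ℂ) |r|
  -- At the centre the summand is zero by the conventions `0⁻¹ = 0` and `log 0 = 0`; a zero of `ψ`
  -- there is counted by the separate `log r` term.
  · rcases eq_or_ne u 0 with rfl | h0
    · simp
    refine mul_nonneg (hD _) (Real.log_nonneg ?_)
    rw [mem_closedBall_zero_iff, abs_of_pos (by positivity)] at hu
    rw [zero_sub, norm_neg, ← div_eq_mul_inv, one_le_div (norm_pos_iff.2 h0)]
    exact hu
  · rw [Function.locallyFinsuppWithin.apply_eq_zero_of_notMem _ hu]
    simp

/-- On `|z| = r` the logarithm of `M_z ≤ C` reads `2 log|ψ| + |φ|² - r² ≤ log C`. With `2r|φ| ≤ |φ|²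
+ r²` this bounds `|φ|` linearly in `-log|ψ|`, whose circle mean is bounded above by Jensen. -/
theorem exists_circleAverage_norm_le {ψ φ : ℂ → ℂ} (hψ : Differentiable ℂ ψ) (h0 : ψ ≠ 0)
    (hφ : Differentiable ℂ φ) {C : ℝ} (hC : ∀ z, symbolM ψ φ z ≤ C) :
    ∃ D : ℝ, ∀ r : ℝ, 1 ≤ r → Real.circleAverage (fun z => ‖φ z‖) 0 r ≤ r + D / r := by
  obtain ⟨L, hL⟩ := exists_le_circleAverage_log_norm hψ
  refine ⟨Real.log C / 2 - L, fun r hr => ?_⟩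
  have hr0 : 0 < r := by positivity
  have hlog : CircleIntegrable (fun z => Real.log ‖ψ z‖) 0 r :=
    MeromorphicOn.circleIntegrable_log_norm fun z _ => (hψ.analyticAt z).meromorphicAt
  have hpt : ∀ z, ‖z‖ = r → ψ z ≠ 0 →
      ‖φ z‖ ≤ (r + Real.log C / 2 / r) - r⁻¹ * Real.log ‖ψ z‖ := fun z hz hψz => by
    have hp : 0 < ‖ψ z‖ := norm_pos_iff.2 hψz
    have h1 := Real.log_le_log (by unfold symbolM; positivity) (hC z)
    rw [symbolM, Real.log_mul (by positivity) (by positivity), Real.log_pow, Real.log_exp, hz] at h1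
    push_cast at h1
    have e : (r + Real.log C / 2 / r) - r⁻¹ * Real.log ‖ψ z‖ =
        (2 * r ^ 2 + Real.log C - 2 * Real.log ‖ψ z‖) / (2 * r) := by
      field_simp
    rw [e, le_div_iff₀ (by positivity)]
    nlinarith [sq_nonneg (‖φ z‖ - r)]
  -- At zeros of `ψ` the value `log 0 = 0` carries no information, so the pointwise bound is only
  -- used off this null set.
  have hne : ∀ᵐ θ ∂volume.restrict (Set.Icc 0 (2 * π)), ψ (circleMap 0 r θ) ≠ 0 := by
    have h1 : ∀ᶠ z in codiscrete ℂ, ψ z ≠ 0 :=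
      ((AnalyticOnNhd.eqOn_zero_or_eventually_ne_zero_of_preconnected
        (fun z _ => hψ.analyticAt z) isPreconnected_univ).resolve_left fun h =>
          h0 (funext fun z => h (Set.mem_univ z)))
    have h2 := circleMap_preimage_codiscrete (c := 0) hr0.ne'
      (codiscreteWithin_mono (Set.subset_univ _) h1)
    exact ae_restrict_le_codiscreteWithin measurableSet_Icc
      (codiscreteWithin_mono (Set.subset_univ _) h2)
  have hi : CircleIntegrable (fun z => ‖φ z‖) 0 r :=
    hφ.continuous.norm.continuousOn.circleIntegrable hr0.le
  have hc : CircleIntegrable (fun _ : ℂ => r + Real.log C / 2 / r) 0 r :=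
    circleIntegrable_const _ _ _
  have hl : CircleIntegrable (fun z => r⁻¹ * Real.log ‖ψ z‖) 0 r := hlog.const_mul _
  have hle : Real.circleAverage (fun z => ‖φ z‖) 0 r ≤
      Real.circleAverage (fun z => (r + Real.log C / 2 / r) - r⁻¹ * Real.log ‖ψ z‖) 0 r := by
    unfold Real.circleAverage
    refine smul_le_smul_of_nonneg_left ?_ (by positivity)
    refine intervalIntegral.integral_mono_ae_restrict Real.two_pi_pos.le hi (hc.sub hl) ?_
    filter_upwards [hne] with θ hθ
    exact hpt _ (by rw [norm_circleMap_zero, abs_of_pos hr0]) hθ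
  have e : Real.circleAverage (fun z => (r + Real.log C / 2 / r) - r⁻¹ * Real.log ‖ψ z‖) 0 r =
      (r + Real.log C / 2 / r) - r⁻¹ * Real.circleAverage (fun z => Real.log ‖ψ z‖) 0 r := by
    have h1 := Real.circleAverage_sub hc hl
    have h2 := Real.circleAverage_fun_smul (𝕜 := ℝ) (a := r⁻¹)
      (f := fun z => Real.log ‖ψ z‖) (c := 0) (R := r)
    simp only [smul_eq_mul] at h2
    rw [← h2, ← Real.circleAverage_const (r + Real.log C / 2 / r) 0 r, ← h1,
      Real.circleAverage_const]
    rfl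
  rw [e] at hle
  refine hle.trans ?_
  have := mul_le_mul_of_nonneg_left (hL r hr) (inv_nonneg.2 hr0.le)
  rw [sub_div, div_eq_inv_mul L]
  linarith

/-- An entire function of linear growth in the mean is affine. -/
theorem affine_of_circleAverage_norm_le {φ : ℂ → ℂ} (hφ : Differentiable ℂ φ) {D : ℝ}
    (hD : ∀ r : ℝ, 1 ≤ r → Real.circleAverage (fun z => ‖φ z‖) 0 r ≤ r + D / r) :
    ∃ a l : ℂ, ‖l‖ ≤ 1 ∧ ∀ w, φ w = a + l * w := by
  set p := cauchyPowerSeries φ 0 1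
  have hp : HasFPowerSeriesOnBall φ p 0 ∞ := by
    simpa using hφ.hasFPowerSeriesOnBall 0 (R := 1) one_pos
  -- Cauchy's estimate in mean form; the Taylor series does not depend on the radius, so `r` is free
  -- to tend to infinity.
  have hbound : ∀ n : ℕ, ∀ r : ℝ, 1 ≤ r → ‖p n‖ ≤ (r + D / r) * r⁻¹ ^ n := fun n r hr => by
    have hr0 : 0 < r := by positivity
    have h1 := hφ.hasFPowerSeriesOnBall 0 (R := ⟨r, hr0.le⟩) hr0
    have h2 : p = cauchyPowerSeries φ 0 r :=
      hp.hasFPowerSeriesAt.eq_formalMultilinearSeries h1.hasFPowerSeriesAt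
    have h3 := norm_cauchyPowerSeries_le φ 0 r n
    rw [← h2, abs_of_pos hr0] at h3
    exact h3.trans (mul_le_mul_of_nonneg_right (hD r hr) (by positivity))
  have hlim : Tendsto (fun r : ℝ => r⁻¹) atTop (𝓝 0) := tendsto_inv_atTop_zero
  -- The coefficient of `r` in the mean bound being exactly one is what gives `|λ| ≤ 1`.
  have hone : ‖p 1‖ ≤ 1 := by
    have ht : Tendsto (fun r : ℝ => 1 + D * r⁻¹ ^ 2) atTop (𝓝 1) := by
      simpa using ((hlim.pow 2).const_mul D).const_add 1
    refine ge_of_tendsto ht ?_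
    filter_upwards [eventually_ge_atTop 1] with r hr
    refine (hbound 1 r hr).trans (le_of_eq ?_)
    have : r ≠ 0 := by positivity
    field_simp
  have hzero : ∀ n, 2 ≤ n → p n = 0 := fun n hn => by
    have ht : Tendsto (fun r : ℝ => r⁻¹ ^ (n - 1) + D * r⁻¹ ^ (n + 1)) atTop (𝓝 0) := by
      have h := (hlim.pow (n - 1)).add ((hlim.pow (n + 1)).const_mul D)
      rwa [zero_pow (by omega), zero_pow (by omega), mul_zero, add_zero] at h
    rw [← norm_le_zero_iff]
    refine ge_of_tendsto ht ?_
    filter_upwards [eventually_ge_atTop 1] with r hr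
    refine (hbound n r hr).trans (le_of_eq ?_)
    obtain ⟨m, rfl⟩ : ∃ m, n = m + 1 := ⟨n - 1, by omega⟩
    have : r * r⁻¹ = 1 := mul_inv_cancel₀ (by positivity)
    simp only [Nat.add_sub_cancel, div_eq_mul_inv]
    linear_combination r⁻¹ ^ m * this
  refine ⟨p.coeff 0, p.coeff 1, ?_, fun w => ?_⟩
  · rwa [← FormalMultilinearSeries.norm_apply_eq_norm_coef]
  · have h1 := hp.hasSum (y := w) (by simp)
    rw [zero_add] at h1
    have h2 := hasSum_sum_of_ne_finset_zero (f := fun n => p n fun _ => w)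
      (L := .unconditional ℕ) (s := Finset.range 2) fun n hn => by
        rw [hzero n (by rwa [Finset.mem_range, not_lt] at hn)]; rfl
    rw [h1.unique h2, Finset.sum_range_succ, Finset.sum_range_one,
      FormalMultilinearSeries.apply_eq_pow_smul_coeff,
      FormalMultilinearSeries.apply_eq_pow_smul_coeff]
    simp [mul_comm]

/-! ### Matrix elements of weighted composition operators -/

section WeightedComposition

variable {ψ φ : ℂ → ℂ} {W : FockSpace →L[ℂ] FockSpace}

theorem IsWeightedComposition.entire_apply (hW : IsWeightedComposition ψ φ W) (f : FockSpace)
    (w : ℂ) : entire (W f) w = ψ w * entire f (φ w) :=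
  congrFun (hW f) w

/-- Pairing with `k_z` evaluates at `z`, and `W k_{φ(z)}` takes there the value `ψ(z)
k_{φ(z)}(φ(z))`. Through this identity `M_z` sees both the norm of `W` and its membership in the
algebra. -/
theorem IsWeightedComposition.norm_inner_sq (hW : IsWeightedComposition ψ φ W) (z : ℂ) :
    ‖(inner ℂ (kvec z) (W (kvec (φ z))) : ℂ)‖ ^ 2 = symbolM ψ φ z := by
  have h : Real.exp (-(‖z‖ ^ 2 / 2)) * Real.exp (‖φ z‖ ^ 2 / 2) =
      Real.exp ((‖φ z‖ ^ 2 - ‖z‖ ^ 2) / 2) := by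
    rw [← Real.exp_add]
    ring_nf
  have h2 : Real.exp (‖φ z‖ ^ 2 - ‖z‖ ^ 2) = Real.exp ((‖φ z‖ ^ 2 - ‖z‖ ^ 2) / 2) ^ 2 := by
    rw [← Real.exp_nat_mul]
    ring_nf
  rw [inner_kvec, hW, norm_mul, norm_mul, norm_entire_kvec, Complex.norm_real,
    Real.norm_of_nonneg (Real.exp_pos _).le, symbolM, h2, ← h]
  simp
  ring

theorem symbolM_nonneg (ψ φ : ℂ → ℂ) (z : ℂ) : 0 ≤ symbolM ψ φ z := by
  unfold symbolM; positivity

theorem IsWeightedComposition.symbolM_le (hW : IsWeightedComposition ψ φ W) (z : ℂ) :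
    symbolM ψ φ z ≤ ‖W‖ ^ 2 := by
  rw [← hW.norm_inner_sq]
  gcongr
  refine (norm_inner_le_norm _ _).trans ?_
  simpa [norm_kvec] using W.le_opNorm (kvec (φ z))

theorem IsWeightedComposition.eq_zero (hW : IsWeightedComposition 0 φ W) : W = 0 := by
  refine ext_repr fun z w => ?_
  rw [hW.entire_apply, zero_apply, ← inner_repr w 0, inner_zero_right, Pi.zero_apply, zero_mul]

/-- For `λ ≠ 1` the displacement `φ(z) - z = a + (λ - 1)z` tends to infinity, so the matrix elements
computing `M_z` lie far off the diagonal. -/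
theorem IsWeightedComposition.tendsto_symbolM_of_mem (hW : IsWeightedComposition ψ φ W)
    (hT : W ∈ toeplitzAlgebra) {a l : ℂ} (hφ : ∀ w, φ w = a + l * w) (hl : l ≠ 1) :
    Tendsto (symbolM ψ φ) (cocompact ℂ) (𝓝 0) := by
  have h : Tendsto (fun z => ‖(inner ℂ (kvec z) (W (kvec (φ z))) : ℂ)‖) (cocompact ℂ) (𝓝 0) := by
    rw [Metric.tendsto_nhds]
    intro ε hε
    obtain ⟨R, hR⟩ := exists_norm_inner_lt_of_mem hT hε
    have hl' : 0 < ‖l - 1‖ := norm_pos_iff.2 (sub_ne_zero.2 hl)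
    filter_upwards [(tendsto_norm_cocompact_atTop (E := ℂ)).eventually_ge_atTop
      ((R + ‖a‖) / ‖l - 1‖)] with z hz
    rw [dist_zero_right, norm_norm]
    refine hR _ _ ?_
    rw [div_le_iff₀ hl', ← norm_mul] at hz
    have := norm_sub_le (φ z - z) a
    rw [show φ z - z - a = z * (l - 1) by rw [hφ]; ring] at this
    linarith
  have := h.pow 2
  simpa only [hW.norm_inner_sq, ne_eq, OfNat.ofNat_ne_zero, not_false_eq_true, zero_pow] using this

/-- Since `|λz| = |z|`, the exponent `|φ(z)|² - |z|²` is the real part of an affine function of `z`.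
This makes `M_z` the squared modulus of an entire function, up to a constant, and opens the way to
Liouville's theorem. -/
theorem symbolM_eq_of_norm_eq_one {a l : ℂ} (hφ : ∀ w, φ w = a + l * w) (hl : ‖l‖ = 1) (z : ℂ) :
    symbolM ψ φ z =
      ‖ψ z * Complex.exp (starRingEnd ℂ a * l * z)‖ ^ 2 * Real.exp (‖a‖ ^ 2) := by
  have h : ‖φ z‖ ^ 2 - ‖z‖ ^ 2 = 2 * (starRingEnd ℂ a * l * z).re + ‖a‖ ^ 2 := by
    have h1 : ‖l * z‖ ^ 2 = ‖z‖ ^ 2 := by rw [norm_mul, hl, one_mul]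
    rw [hφ, ← h1]
    simp only [← Complex.normSq_eq_norm_sq, Complex.normSq_add]
    have : (a * starRingEnd ℂ (l * z)).re = (starRingEnd ℂ a * l * z).re := by
      rw [← Complex.conj_re]
      congr 1
      simp only [map_mul, Complex.conj_conj]
      ring
    rw [this]
    ring
  rw [symbolM, h, Real.exp_add, norm_mul, Complex.norm_exp, mul_pow, ← Real.exp_nat_mul]
  push_cast
  ring

theorem differentiable_mul_exp (hψ : Differentiable ℂ ψ) (b : ℂ) :
    Differentiable ℂ fun z => ψ z * Complex.exp (b * z) := by
  fun_prop

theorem IsWeightedComposition.eq_one_of_mem (hψ : Differentiable ℂ ψ) (h0 : ψ ≠ 0)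
    (hW : IsWeightedComposition ψ φ W) (hT : W ∈ toeplitzAlgebra) {a l : ℂ}
    (hφ : ∀ w, φ w = a + l * w) (hl : ‖l‖ = 1) : l = 1 := by
  by_contra hne
  have ht := (hW.tendsto_symbolM_of_mem hT hφ hne).div_const (Real.exp (‖a‖ ^ 2))
  simp only [symbolM_eq_of_norm_eq_one hφ hl, mul_div_cancel_right₀ _ (Real.exp_pos _).ne',
    zero_div] at ht
  have ht' := ht.sqrt
  simp only [Real.sqrt_sq (norm_nonneg _), Real.sqrt_zero] at ht'
  refine h0 (funext fun z => ?_)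
  have := (differentiable_mul_exp hψ (starRingEnd ℂ a * l)).apply_eq_of_tendsto_cocompact z
    (tendsto_zero_iff_norm_tendsto_zero.2 ht')
  exact (mul_eq_zero.1 this).resolve_right (Complex.exp_ne_zero _)

/-- A bounded weighted composition operator whose symbol is a translation is a multiple of a Weyl
operator. -/
theorem IsWeightedComposition.exists_eq_smul_weyl (hψ : Differentiable ℂ ψ)
    (hW : IsWeightedComposition ψ φ W) {a : ℂ} (hφ : ∀ w, φ w = a + 1 * w) :
    ∃ c z : ℂ, W = c • weyl z := by
  have hd := differentiable_mul_exp hψ (starRingEnd ℂ a * 1)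
  obtain ⟨c, hc⟩ := hd.exists_const_forall_eq_of_bounded <| by
    refine isBounded_iff_forall_norm_le.2 ⟨‖W‖, ?_⟩
    rintro _ ⟨z, rfl⟩
    have h1 := hW.symbolM_le z
    rw [symbolM_eq_of_norm_eq_one hφ norm_one] at h1
    refine abs_le_of_sq_le_sq' ?_ (norm_nonneg _) |>.2
    refine le_trans (le_mul_of_one_le_right (by positivity) ?_) h1
    exact Real.one_le_exp (by positivity)
  -- Liouville gives `ψ(w) = c exp(-āw)`; the factor `exp(|a|²/2)` undoes the normalization of
  -- `k_{-a}`.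
  refine ⟨c * Complex.exp ((‖a‖ : ℂ) ^ 2 / 2), -a, ext_repr fun v w => ?_⟩
  rw [hW.entire_apply, smul_apply, entire_smul, Pi.smul_apply, entire_weyl, smul_eq_mul, ← hc w, hφ,
    show a + 1 * w = w - -a by ring, ← mul_assoc, kernel, mul_assoc (ψ w), mul_assoc (ψ w),
    ← Complex.exp_add, ← Complex.exp_add]
  congr 1
  rw [map_neg, norm_neg, show starRingEnd ℂ a * 1 * w + (‖a‖ : ℂ) ^ 2 / 2 +
    (w * -starRingEnd ℂ a - (‖a‖ : ℂ) ^ 2 / 2) = 0 by ring, Complex.exp_zero, mul_one]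

open InnerProductSpace in
theorem IsWeightedComposition.eq_rankOne (hψ : IsFock ψ) (hW : IsWeightedComposition ψ φ W)
    {a : ℂ} (hφ : ∀ w, φ w = a) : W = rankOne ℂ (ofIsFock ψ hψ) (repr a) := by
  refine ext_repr fun v w => ?_
  rw [hW.entire_apply, rankOne_apply, entire_smul, Pi.smul_apply, entire_ofIsFock, inner_repr,
    hφ, smul_eq_mul, mul_comm]

end WeightedComposition

open InnerProductSpace in
theorem isCompactOperator_rankOne (x y : FockSpace) : IsCompactOperator (rankOne ℂ x y) := by
  rw [rankOne_def']
  exact (isCompactOperator_of_locallyCompactSpace_rng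
    (ContinuousLinearMap.toSpanSingleton ℂ x)).comp_clm (innerSL ℂ y)

/-! ### Norm estimates and compactness for affine symbols -/

/-- Affine substitutions scale Lebesgue measure by a constant. -/
theorem exists_lintegral_comp_affine (a : ℂ) {l : ℂ} (hl : l ≠ 0) :
    ∃ c : NNReal, ∀ g : ℂ → ℝ≥0∞, Measurable g →
      ∫⁻ w, g (a + l * w) = c * ∫⁻ w, g w := by
  let e : ℂ ≃ₗ[ℝ] ℂ := (LinearEquiv.smulOfNeZero ℂ ℂ l hl).restrictScalars ℝ
  have hmap := Measure.map_linearMap_addHaar_eq_smul_addHaar (μ := (volume : Measure ℂ))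
    (f := (e : ℂ →ₗ[ℝ] ℂ)) e.isUnit_det'.ne_zero
  refine ⟨Real.toNNReal |(LinearMap.det (e : ℂ →ₗ[ℝ] ℂ))⁻¹|, fun g hg => ?_⟩
  have hm : Measurable fun w => l * w := by fun_prop
  have h1 := lintegral_map (μ := volume) (f := fun u => g (a + u)) (by fun_prop) hm
  have h2 : Measure.map (fun w => l * w) (volume : Measure ℂ) =
      ENNReal.ofReal |(LinearMap.det (e : ℂ →ₗ[ℝ] ℂ))⁻¹| • volume := hmap
  rw [← h1, h2, lintegral_smul_measure, lintegral_add_left_eq_self, smul_eq_mul]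
  rfl

/-- A weighted norm estimate for composition with an affine map. -/
theorem exists_lintegral_weighted_le (a : ℂ) {l : ℂ} (hl : l ≠ 0) :
    ∃ c : NNReal, ∀ (ψ F : ℂ → ℂ) (ε κ : ℝ), Continuous ψ → Continuous F → 0 ≤ ε → 0 ≤ κ →
      (∀ w, symbolM ψ (fun w => a + l * w) w * ‖F (a + l * w)‖ ^ 2 ≤
        ε * ‖F (a + l * w)‖ ^ 2 + κ) →
      ∫⁻ w, ‖ψ w * F (a + l * w)‖ₑ ^ 2 ∂gaussian ≤
        c * (ENNReal.ofReal ε * ∫⁻ w, ‖F w‖ₑ ^ 2 ∂gaussian + ENNReal.ofReal κ) := by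
  obtain ⟨c, hc⟩ := exists_lintegral_comp_affine a hl
  refine ⟨c, fun ψ F ε κ hψ hF hε hκ h => ?_⟩
  have hen : ∀ z : ℂ, ‖z‖ₑ ^ 2 = ENNReal.ofReal (‖z‖ ^ 2) := fun z => by
    rw [← ofReal_norm, ENNReal.ofReal_pow (norm_nonneg _)]
  have e : ENNReal.ofReal ε * ∫⁻ w, ‖F w‖ₑ ^ 2 ∂gaussian + ENNReal.ofReal κ =
      ∫⁻ w, (ENNReal.ofReal ε * ‖F w‖ₑ ^ 2 + ENNReal.ofReal κ) ∂gaussian := by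
    rw [lintegral_add_right _ measurable_const, lintegral_const_mul _ (by fun_prop),
      lintegral_const, measure_univ, mul_one]
  rw [e, lintegral_gaussian _ (by fun_prop), lintegral_gaussian _ (by fun_prop),
    ← hc _ (by fun_prop)]
  refine lintegral_mono fun w => ?_
  simp only [hen]
  rw [← ENNReal.ofReal_mul hε, ← ENNReal.ofReal_add (by positivity) hκ,
    ← ENNReal.ofReal_mul (by positivity), ← ENNReal.ofReal_mul (by positivity)]
  refine ENNReal.ofReal_le_ofReal ?_
  refine le_trans (le_of_eq ?_) (mul_le_mul_of_nonneg_left (h w) (by positivity))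
  -- The exponential in `M` is the ratio of the Gaussian weights at `w` and at `a + lw`, which
  -- prepares the affine change of variables.
  have : Real.exp (-‖w‖ ^ 2) = Real.exp (-‖a + l * w‖ ^ 2) *
      Real.exp (‖a + l * w‖ ^ 2 - ‖w‖ ^ 2) := by
    rw [← Real.exp_add]
    ring_nf
  rw [this, symbolM, norm_mul]
  ring

theorem isCompactOperator_comp_starProjection (W : FockSpace →L[ℂ] FockSpace)
    (S : Submodule ℂ FockSpace) [FiniteDimensional ℂ S] :
    IsCompactOperator (W ∘L S.starProjection) := by
  have : ProperSpace S := FiniteDimensional.proper ℂ S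
  have h : IsCompactOperator (S.subtypeL : S → FockSpace) :=
    isCompactOperator_of_locallyCompactSpace_rng S.subtypeL
  exact (h.comp_clm S.orthogonalProjectionOnto).clm_comp W

theorem isCompactOperator_of_forall_exists_norm_le {W : FockSpace →L[ℂ] FockSpace}
    (h : ∀ ε > 0, ∃ V : FockSpace →L[ℂ] FockSpace, IsCompactOperator V ∧ ‖W - V‖ < ε) :
    IsCompactOperator W := by
  have hc := isClosed_setOfPred_isCompactOperator (σ₁₂ := RingHom.id ℂ) (M₁ := FockSpace)
    (M₂ := FockSpace)
  refine hc.closure_subset (Metric.mem_closure_iff.2 fun ε hε => ?_)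
  obtain ⟨V, hV, hlt⟩ := h ε hε
  exact ⟨V, hV, by rwa [dist_eq_norm]⟩

/-- A bounded weighted composition operator with invertible affine symbol is compact if `M_z`
vanishes at infinity. -/
theorem IsWeightedComposition.isCompactOperator {ψ φ : ℂ → ℂ} {W : FockSpace →L[ℂ] FockSpace}
    (hψ : Differentiable ℂ ψ) (hW : IsWeightedComposition ψ φ W) {a l : ℂ}
    (hφ : ∀ w, φ w = a + l * w) (hl : l ≠ 0)
    (hM : Tendsto (symbolM ψ φ) (cocompact ℂ) (𝓝 0)) : IsCompactOperator W := by
  obtain rfl : φ = fun w => a + l * w := funext hφ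
  obtain ⟨c, hc⟩ := exists_lintegral_weighted_le a hl
  refine isCompactOperator_of_forall_exists_norm_le fun δ' hδ' => ?_
  obtain ⟨δ, hδ, hδδ⟩ := exists_between hδ'
  set B := ‖W‖ ^ 2
  have hB : 0 ≤ B := by positivity
  -- The final estimate is `‖Wg‖² ≤ c(ε + Bε²)‖f‖²`; the two terms come from the regions where `M`
  -- is small and where `g ∘ φ` is small.
  obtain ⟨ε, hε, hε1, hεc⟩ : ∃ ε : ℝ, 0 < ε ∧ ε ≤ 1 ∧ c * (ε + B * ε ^ 2) ≤ δ ^ 2 := by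
    refine ⟨min 1 (δ ^ 2 / ((c + 1) * (B + 1))), by positivity, min_le_left _ _, ?_⟩
    set ε := min 1 (δ ^ 2 / ((c + 1) * (B + 1)))
    have h0 : 0 < ε := by positivity
    have h1 : ε ≤ 1 := min_le_left _ _
    have h2 : ε * ((c + 1) * (B + 1)) ≤ δ ^ 2 :=
      (le_div_iff₀ (by positivity)).1 (min_le_right _ _)
    have h3 : ε + B * ε ^ 2 ≤ ε * (B + 1) := by
      have : B * ε ^ 2 ≤ B * ε := mul_le_mul_of_nonneg_left (by nlinarith) hB
      linarith
    calc (c : ℝ) * (ε + B * ε ^ 2) ≤ (c + 1) * (ε * (B + 1)) := by gcongr; linarith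
      _ = ε * ((c + 1) * (B + 1)) := by ring
      _ ≤ _ := h2
  have hMε : ∀ᶠ w in cocompact ℂ, symbolM ψ (fun w => a + l * w) w < ε :=
    hM.eventually_lt_const hε
  obtain ⟨s, hs, hsM⟩ := mem_cocompact'.1 hMε
  -- The kernels at the points of `φ(s)` form a norm-compact set. A function orthogonal to a finite
  -- `ε`-net of it is uniformly small on `φ(s)`, which handles the region where `M` is merely
  -- bounded.
  have hK : IsCompact (repr '' ((fun w => a + l * w) '' s)) :=
    (hs.image (by fun_prop)).image continuous_repr
  obtain ⟨t, ht, hKt⟩ := Metric.totallyBounded_iff.1 hK.totallyBounded ε hε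
  let S := Submodule.span ℂ t
  have : FiniteDimensional ℂ S := FiniteDimensional.span_of_finite ℂ ht
  refine ⟨W ∘L S.starProjection, isCompactOperator_comp_starProjection W S, ?_⟩
  refine lt_of_le_of_lt (ContinuousLinearMap.opNorm_le_bound _ hδ.le fun f => ?_) hδδ
  set g := f - S.starProjection f with hg
  have hWg : (W - W ∘L S.starProjection) f = W g := by simp [hg]
  have hgf : ‖g‖ ≤ ‖f‖ := by
    rw [hg, ← Submodule.starProjection_orthogonal_val]
    exact Submodule.norm_starProjection_apply_le _ _
  have hsmall : ∀ w ∈ s, ‖entire g (a + l * w)‖ ≤ ε * ‖f‖ := fun w hw => by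
    obtain ⟨v, hv, hrv⟩ := Set.mem_iUnion₂.1 (hKt ⟨_, ⟨w, hw, rfl⟩, rfl⟩)
    have horth : inner ℂ v g = 0 :=
      Submodule.sub_starProjection_mem_orthogonal f v (Submodule.subset_span hv)
    rw [← inner_repr, ← sub_zero (inner ℂ _ _), ← horth, ← inner_sub_left]
    refine (norm_inner_le_norm _ _).trans ?_
    rw [Metric.mem_ball, dist_eq_norm] at hrv
    gcongr
  have hkey := hc ψ (entire g) ε (B * (ε * ‖f‖) ^ 2) hψ.continuous
    (differentiable_entire g).continuous hε.le (by positivity) fun w => by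
      by_cases hw : w ∈ s
      · refine le_add_of_nonneg_of_le (by positivity) ?_
        exact mul_le_mul (hW.symbolM_le w) (by gcongr; exact hsmall w hw) (by positivity) hB
      · have hlt : symbolM ψ (fun w => a + l * w) w < ε := by
          by_contra hcon
          exact hw (hsM hcon)
        refine le_add_of_le_of_nonneg ?_ (by positivity)
        gcongr
  have hWe : ∫⁻ w, ‖ψ w * entire g (a + l * w)‖ₑ ^ 2 ∂gaussian = ENNReal.ofReal (‖W g‖ ^ 2) := by
    rw [norm_sq_eq_lintegral, hW g]
  rw [hWe, ← norm_sq_eq_lintegral, ← ENNReal.ofReal_mul hε.le,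
    ← ENNReal.ofReal_add (by positivity) (by positivity), ← ENNReal.ofReal_coe_nnreal,
    ← ENNReal.ofReal_mul (by positivity), ENNReal.ofReal_le_ofReal_iff (by positivity)] at hkey
  rw [hWg]
  refine abs_le_of_sq_le_sq' ?_ (by positivity) |>.2
  calc ‖W g‖ ^ 2 ≤ c * (ε * ‖g‖ ^ 2 + B * (ε * ‖f‖) ^ 2) := hkey
    _ ≤ c * (ε * ‖f‖ ^ 2 + B * (ε * ‖f‖) ^ 2) := by gcongr
    _ = c * (ε + B * ε ^ 2) * ‖f‖ ^ 2 := by ring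
    _ ≤ δ ^ 2 * ‖f‖ ^ 2 := by gcongr
    _ = (δ * ‖f‖) ^ 2 := by ring

/-- Composition with a strict affine contraction: `M_z` is dominated by a Gaussian. -/
theorem exists_symbolM_one_le (a : ℂ) {l : ℂ} (hl : ‖l‖ < 1) :
    ∃ A b : ℝ, 0 < b ∧ ∀ w, symbolM (fun _ => 1) (fun w => a + l * w) w ≤
      Real.exp (A - b * ‖w‖ ^ 2) := by
  have hd : 0 < 1 - ‖l‖ ^ 2 := by nlinarith [norm_nonneg l]
  refine ⟨‖a‖ ^ 2 + 2 * (‖a‖ * ‖l‖) ^ 2 / (1 - ‖l‖ ^ 2), (1 - ‖l‖ ^ 2) / 2, half_pos hd,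
    fun w => ?_⟩
  rw [symbolM, norm_one, one_pow, one_mul, Real.exp_le_exp]
  have h1 : ‖a + l * w‖ ^ 2 ≤ (‖a‖ + ‖l‖ * ‖w‖) ^ 2 := by
    gcongr
    exact (norm_add_le _ _).trans (by rw [norm_mul])
  -- Completing the square absorbs the cross term into half of the gap `1 - |l|²`.
  have h2 : 2 * (‖a‖ * ‖l‖) * ‖w‖ ≤
      2 * (‖a‖ * ‖l‖) ^ 2 / (1 - ‖l‖ ^ 2) + (1 - ‖l‖ ^ 2) / 2 * ‖w‖ ^ 2 := by
    rw [← sub_le_iff_le_add, le_div_iff₀ hd]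
    nlinarith [sq_nonneg (2 * (‖a‖ * ‖l‖) - (1 - ‖l‖ ^ 2) * ‖w‖)]
  nlinarith

theorem tendsto_symbolM_one (a : ℂ) {l : ℂ} (hl : ‖l‖ < 1) :
    Tendsto (symbolM (fun _ => 1) (fun w => a + l * w)) (cocompact ℂ) (𝓝 0) := by
  obtain ⟨A, b, hb, h⟩ := exists_symbolM_one_le a hl
  refine squeeze_zero (symbolM_nonneg _ _) h (Real.tendsto_exp_atBot.comp ?_)
  have h1 := (((tendsto_pow_atTop two_ne_zero).comp
    (tendsto_norm_cocompact_atTop (E := ℂ))).const_mul_atTop hb)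
  simpa [sub_eq_add_neg] using tendsto_atBot_add_const_left _ A (tendsto_neg_atTop_atBot.comp h1)

/-- Boundedness of composition with a strict affine contraction. -/
theorem exists_isWeightedComposition_one (a : ℂ) {l : ℂ} (h0 : l ≠ 0) (hl : ‖l‖ < 1) :
    ∃ W : FockSpace →L[ℂ] FockSpace,
      IsWeightedComposition (fun _ => 1) (fun w => a + l * w) W := by
  obtain ⟨A, b, hb, hM⟩ := exists_symbolM_one_le a hl
  obtain ⟨c, hc⟩ := exists_lintegral_weighted_le a h0
  have hle : ∀ f : FockSpace, ∫⁻ w, ‖entire f (a + l * w)‖ₑ ^ 2 ∂gaussian ≤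
      ENNReal.ofReal (c * (Real.exp A * ‖f‖ ^ 2)) := fun f => by
    -- Boundedness needs only `M ≤ exp A`, so the additive error is zero.
    have := hc (fun _ => 1) (entire f) (Real.exp A) 0 continuous_const
      (differentiable_entire f).continuous (Real.exp_pos _).le le_rfl fun w => by
        rw [add_zero]
        gcongr
        refine (hM w).trans (Real.exp_le_exp.2 ?_)
        nlinarith [sq_nonneg ‖w‖]
    simp only [one_mul, ENNReal.ofReal_zero, add_zero] at this
    rwa [← norm_sq_eq_lintegral, ← ENNReal.ofReal_mul (Real.exp_pos _).le,
      ← ENNReal.ofReal_coe_nnreal, ← ENNReal.ofReal_mul (by positivity)] at this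
  have hF : ∀ f : FockSpace, IsFock fun w => entire f (a + l * w) := fun f => by
    have hd : Differentiable ℂ fun w => entire f (a + l * w) :=
      (differentiable_entire f).comp (by fun_prop : Differentiable ℂ fun w => a + l * w)
    refine ⟨hd, hd.continuous.aestronglyMeasurable, ?_⟩
    have := (hle f).trans_lt ENNReal.ofReal_lt_top
    rw [← eLpNorm_two_sq] at this
    exact (ENNReal.pow_lt_top_iff.1 this).resolve_right two_ne_zero
  let W : FockSpace →L[ℂ] FockSpace := LinearMap.mkContinuous
    { toFun := fun f => ofIsFock _ (hF f)
      map_add' := fun f g => entire_injective <| by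
        funext w
        simp only [entire_add, entire_ofIsFock, Pi.add_apply]
      map_smul' := fun c f => entire_injective <| by
        funext w
        simp only [entire_smul, entire_ofIsFock, Pi.smul_apply, RingHom.id_apply] }
    √(c * Real.exp A) fun f => by
      refine abs_le_of_sq_le_sq' ?_ (by positivity) |>.2
      rw [mul_pow, Real.sq_sqrt (by positivity), mul_assoc,
        ← ENNReal.ofReal_le_ofReal_iff (by positivity), norm_sq_eq_lintegral]
      simp only [LinearMap.coe_mk, AddHom.coe_mk, entire_ofIsFock]
      exact hle f
  refine ⟨W, fun f => ?_⟩
  simp only [one_mul]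
  exact entire_ofIsFock _ (hF f)

end
end Fock

/-! ### Assembly of the main theorem -/

theorem mainTheorem2 :
    (∀ ψ φ : ℂ → ℂ, Fock.IsFock ψ → Differentiable ℂ φ →
      ∀ W : Fock.FockSpace →L[ℂ] Fock.FockSpace, Fock.IsWeightedComposition ψ φ W →
        (W ∈ Fock.toeplitzAlgebra ↔
          IsCompactOperator W ∨ ∃ c z : ℂ, W = c • Fock.weyl z) ∧
        (ψ ≠ 0 → ∃ a l : ℂ, ‖l‖ ≤ 1 ∧ ∀ w, φ w = a + l * w) ∧
        (∀ a l : ℂ, (∀ w, φ w = a + l * w) →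
          (ψ ≠ 0 → ‖l‖ = 1 → (W ∈ Fock.toeplitzAlgebra ↔ l = 1)) ∧
          (l = 0 → W ∈ Fock.toeplitzAlgebra) ∧
          (0 < ‖l‖ → ‖l‖ < 1 →
            (W ∈ Fock.toeplitzAlgebra ↔
              Tendsto (Fock.symbolM ψ φ) (cocompact ℂ) (𝓝 0))))) ∧
    (∀ a l : ℂ, 0 < ‖l‖ → ‖l‖ < 1 →
      ∃ W : Fock.FockSpace →L[ℂ] Fock.FockSpace,
        Fock.IsWeightedComposition (fun _ => 1) (fun w => a + l * w) W ∧
          W ∈ Fock.toeplitzAlgebra) := by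
  refine ⟨fun ψ φ hψ hφ W hW => ?_, fun a l h0 h1 => ?_⟩
  · have haff : ψ ≠ 0 → ∃ a l : ℂ, ‖l‖ ≤ 1 ∧ ∀ w, φ w = a + l * w := fun hne => by
      obtain ⟨D, hD⟩ := Fock.exists_circleAverage_norm_le hψ.1 hne hφ hW.symbolM_le
      exact Fock.affine_of_circleAverage_norm_le hφ hD
    have hweyl : (∃ c z : ℂ, W = c • Fock.weyl z) → W ∈ Fock.toeplitzAlgebra := by
      rintro ⟨c, z, rfl⟩
      exact Fock.toeplitzAlgebra.smul_mem (Fock.weyl_mem z) c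
    have hzero : ∀ a l : ℂ, (∀ w, φ w = a + l * w) → l = 0 → IsCompactOperator W := by
      rintro a l haw rfl
      rw [hW.eq_rankOne hψ (a := a) fun w => by rw [haw, zero_mul, add_zero]]
      exact Fock.isCompactOperator_rankOne _ _
    refine ⟨⟨fun hT => ?_, fun h => h.elim Fock.mem_toeplitzAlgebra_of_isCompactOperator hweyl⟩,
      haff, fun a l haw => ⟨fun hne hl => ⟨fun hT => hW.eq_one_of_mem hψ.1 hne hT haw hl, ?_⟩,
        fun hl => Fock.mem_toeplitzAlgebra_of_isCompactOperator (hzero a l haw hl),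
        fun h0 h1 => ⟨fun hT => hW.tendsto_symbolM_of_mem hT haw ?_, fun hM =>
          Fock.mem_toeplitzAlgebra_of_isCompactOperator
            (hW.isCompactOperator hψ.1 haw (norm_pos_iff.1 h0) hM)⟩⟩⟩
    -- When `ψ = 0` the map `φ` is arbitrary and no affine form is available, but `W = 0` is
    -- compact.
    · by_cases hne : ψ = 0
      · subst hne
        left
        rw [hW.eq_zero]
        exact isCompactOperator_zero
      · obtain ⟨a, l, hl, haw⟩ := haff hne
        rcases hl.lt_or_eq with hlt | heq
        · left
          by_cases h0 : l = 0
          · exact hzero a l haw h0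
          · refine hW.isCompactOperator hψ.1 haw h0 (hW.tendsto_symbolM_of_mem hT haw ?_)
            rintro rfl
            simp at hlt
        · right
          obtain rfl := hW.eq_one_of_mem hψ.1 hne hT haw heq
          exact hW.exists_eq_smul_weyl hψ.1 haw
    · rintro rfl
      exact hweyl (hW.exists_eq_smul_weyl hψ.1 haw)
    · rintro rfl
      simp at h1
  · have hne : l ≠ 0 := norm_pos_iff.1 h0
    obtain ⟨W, hW⟩ := Fock.exists_isWeightedComposition_one a hne h1
    exact ⟨W, hW, Fock.mem_toeplitzAlgebra_of_isCompactOperator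
      (hW.isCompactOperator (differentiable_const 1) (fun _ => rfl) hne
        (Fock.tendsto_symbolM_one a h1))⟩
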